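/- **Resource expressions.** Resource terms are generated by $$s ::= x \mid \lambda x.s \mid \langle s\rangle \bar t \mid s\oplus\bullet \mid \bullet\oplus s,$$ where $\bar t=[t_1,\dots,t_n]$ ($n\ge 0$) is a resource monomial, i.e. a finite multiset of resource terms; terms are taken up to $\alpha$-equivalence. A resource expression is a resource term or a resource monomial. Write $\bar s\cdot\bar t$ for multiset union, and $\mathbb N\langle X\rangle$ for the finite formal sums of elements of $X$ with coefficients in $\mathbb N$; for $E\in\mathbb N\langle X\rangle$ let $E_x$ be the coefficient of $x$ and $\mathrm{supp}(E)=\{x\mid E_x\neq 0\}$. Sums are either sums of terms or sums of monomials, and all syntactic constructs are extended to sums by (multi)linearity. **Substitution.** For $\bar u=[u_1,\dots,u_n]$ the sum $\partial_x e\cdot\bar u$ is defined by: $\partial_x x\cdot\bar u=u_1$ if $n=1$ and $0$ otherwise; for a variable $y\ne x$, $\partial_x y\cdot\bar u=y$ if $n=0$ and $0$ otherwise; it commutes with $\lambda y.-$ (with $y\neq x$ not free in $\bar u$), $-\oplus\bullet$ and $\bullet\oplus-$; $\partial_x\langle s\rangle\bar t\cdot\bar u=\sum_{(I_1,I_2)}\langle\partial_x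 s\cdot\bar u_{I_1}\rangle\,(\partial_x\bar t\cdot\bar u_{I_2})$; and $\partial_x[t_1,\dots,t_k]\cdot\bar u=\sum_{(I_1,\dots,I_k)}[\partial_x t_1\cdot\bar u_{I_1},\dots,\partial_x t_k\cdot\bar u_{I_k}]$. The sums range over tuples of pairwise disjoint, possibly empty, sets with union $\{1,\dots,n\}$, and $\bar u_I$ is the multiset of the $u_i$ with $i\in I$. **Reduction.** The relation $\to_\partial$ from expressions to finite sums is generated by $$\langle\lambda x.s\rangle\bar t\to\partial_x s\cdot\bar t,\quad \langle s\oplus\bullet\rangle\bar t\to\langle s\rangle\bar t\oplus\bullet,\quad \langle\bullet\oplus s\rangle\bar t\to\bullet\oplus\langle s\rangle\bar t,\quad \lambda x.(s\oplus\bullet)\to(\lambda x.s)\oplus\bullet,\quad \lambda x.(\bullet\oplus s)\to\bullet\oplus(\lambda x.s)$$ and closed under all contexts (under $\lambda$, in the function and in the argument of an application, under $-\oplus\bullet$ and $\bullet\oplus-$, and on one element of a monomial: $[s]\cdot\bar t\to[S']\cdot\bar t$ if $s\to S'$). It is extended to sums by $e+F\to_\partial E'+F$ whenever $e\to_\partial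 E'$. A sum is normal if it does not reduce, and a normal form of $E$ is a normal sum $N$ with $E\to_\partial^*N$. **Coherence.** The relation $\mathrel{\asymp}$ on expressions is inductively generated by: $x\mathrel{\asymp} x$; if $s\mathrel{\asymp} s'$ then $\lambda x.s\mathrel{\asymp}\lambda x.s'$, $s\oplus\bullet\mathrel{\asymp} s'\oplus\bullet$ and $\bullet\oplus s\mathrel{\asymp}\bullet\oplus s'$; if $s\mathrel{\asymp} s'$ and $\bar t\mathrel{\asymp}\bar t'$ then $\langle s\rangle\bar t\mathrel{\asymp}\langle s'\rangle\bar t'$; $s\oplus\bullet\mathrel{\asymp}\bullet\oplus s'$ and $\bullet\oplus s'\mathrel{\asymp} s\oplus\bullet$ for all $s,s'$; $[t_1,\dots,t_n]\mathrel{\asymp}[t_{n+1},\dots,t_{n+m}]$ if $t_i\mathrel{\asymp} t_j$ for all $1\le i,j\le n+m$. An expression $e$ is uniform if $e\mathrel{\asymp} e$. **Multiplicity.** $m(x)=1$; $m(\lambda x.s)=m(s\oplus\bullet)=m(\bullet\oplus s)=m(s)$; $m(\langle s\rangle\bar t)=m(s)\,m(\bar t)$; and $m([t_1]^{n_1}\cdots[t_k]^{n_k})=\prod_{i=1}^k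 n_i!\,m(t_i)^{n_i}$ for pairwise distinct $t_i$. **Theorem.** Let $e$ be a uniform resource expression (a term or a monomial). Then $e$ has exactly one normal form $\mathrm{NF}(e)$ for $\to_\partial$, and for every $e'\in\mathrm{supp}(\mathrm{NF}(e))$, $$\mathrm{NF}(e)_{e'}=\frac{m(e)}{m(e')}.$$ -/

import Mathlib

namespace Resource

/-! ### Resource terms and monomials

Terms up to α-equivalence are written with de Bruijn indices (`lam` binds index `0`; indices that
exceed the number of enclosing binders are the free variables).  Monomials are genuine multisets of
terms.  The set of terms is therefore the initial algebra of the functor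
`X ↦ ℕ ⊕ X ⊕ (X × Multiset X) ⊕ X ⊕ X`. -/

/-- One layer of syntax: `x`, `λ x. s`, `⟨s⟩ t`, `s ⊕ •` and `• ⊕ s`. -/
inductive Layer (X : Type) : Type
  | var (n : ℕ) : Layer X
  | lam (s : X) : Layer X
  | app (s : X) (t : Multiset X) : Layer X
  | inl (s : X) : Layer X
  | inr (s : X) : Layer X

namespace Layer

def map {X Y : Type} (f : X → Y) : Layer X → Layer Y
  | var n => var n
  | lam s => lam (f s)
  | app s t => app (f s) (t.map f)
  | inl s => inl (f s)
  | inr s => inr (f s)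

instance : Functor Layer where
  map := Layer.map

/-- The shape of a layer; an application remembers the size of its monomial. -/
inductive Shape : Type
  | var (n : ℕ) : Shape
  | lam : Shape
  | app (k : ℕ) : Shape
  | inl : Shape
  | inr : Shape

def Shape.arity : Shape → ℕ
  | .var _ => 0
  | .lam => 1
  | .app k => k + 1
  | .inl => 1
  | .inr => 1

def poly : PFunctor.{0, 0} := ⟨Shape, fun a => Fin a.arity⟩

def ofPoly {X : Type} : poly X → Layer X
  | ⟨.var n, _⟩ => var n
  | ⟨.lam, f⟩ => lam (f (0 : Fin 1))
  | ⟨.app k, f⟩ => app (f (0 : Fin (k + 1))) (List.ofFn fun i : Fin k => f i.succ : List X)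
  | ⟨.inl, f⟩ => inl (f (0 : Fin 1))
  | ⟨.inr, f⟩ => inr (f (0 : Fin 1))

noncomputable def toPoly {X : Type} : Layer X → poly X
  | var n => ⟨Shape.var n, fun i : Fin 0 => i.elim0⟩
  | lam s => ⟨Shape.lam, fun _ => s⟩
  | app s t => ⟨Shape.app t.toList.length,
      fun i : Fin (t.toList.length + 1) => Fin.cons (α := fun _ => X) s t.toList.get i⟩
  | inl s => ⟨Shape.inl, fun _ => s⟩
  | inr s => ⟨Shape.inr, fun _ => s⟩

/-- Layers form a quotient of a polynomial functor, so that Mathlib's `QPF.Fix` provides their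
initial algebra, with its recursion and induction principles. -/
noncomputable instance : QPF Layer where
  P := poly
  abs := ofPoly
  repr := toPoly
  abs_repr := by
    intro X x
    cases x with
    | app s t =>
      have h : List.ofFn (fun i : Fin t.toList.length => t.toList[(i : ℕ)]) = t.toList :=
        List.ofFn_getElem
      simp only [ofPoly, toPoly, Fin.cons_zero, Fin.cons_succ, List.get_eq_getElem, h,
        Multiset.coe_toList]
    | _ => rfl
  abs_map := by
    rintro X Y f ⟨a, g⟩
    cases a <;> simp only [PFunctor.map, ofPoly] <;>
      simp [Functor.map, Layer.map, List.map_ofFn, Function.comp_def]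

end Layer

/-- Resource terms. -/
abbrev Term : Type := QPF.Fix Layer

/-- Resource monomials: finite multisets of resource terms. -/
abbrev Mono : Type := Multiset Term

/-- `ℕ⟨X⟩`: finite formal sums of elements of `X` with coefficients in `ℕ`, that is, finite
multisets; the sum is `+`, and the coefficient is the number of occurrences. -/
abbrev Sums (X : Type) : Type := Multiset X

namespace Term

noncomputable def var (n : ℕ) : Term := QPF.Fix.mk (Layer.var n)
noncomputable def lam (s : Term) : Term := QPF.Fix.mk (Layer.lam s)
noncomputable def app (s : Term) (t : Mono) : Term := QPF.Fix.mk (Layer.app s t)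
/-- The term `s ⊕ •`. -/
noncomputable def inl (s : Term) : Term := QPF.Fix.mk (Layer.inl s)
/-- The term `• ⊕ s`. -/
noncomputable def inr (s : Term) : Term := QPF.Fix.mk (Layer.inr s)

/-! ### Renaming -/

/-- The renaming `f`, pushed under one binder. -/
def liftRen (f : ℕ → ℕ) : ℕ → ℕ
  | 0 => 0
  | n + 1 => f n + 1

/-- `rename s f` is `s` with each free variable `n` replaced by the variable `f n`. -/
noncomputable def rename : Term → (ℕ → ℕ) → Term :=
  QPF.Fix.rec fun l : Layer ((ℕ → ℕ) → Term) =>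
    match l with
    | .var n => fun f => var (f n)
    | .lam s => fun f => lam (s (liftRen f))
    | .app s t => fun f => app (s f) (t.map fun a => a f)
    | .inl s => fun f => inl (s f)
    | .inr s => fun f => inr (s f)

theorem rename_var (n : ℕ) (f : ℕ → ℕ) : (var n).rename f = var (f n) := by
  simp only [rename, var, QPF.Fix.rec_eq]; rfl

theorem rename_lam (s : Term) (f : ℕ → ℕ) :
    (lam s).rename f = lam (s.rename (liftRen f)) := by
  simp only [rename, lam, QPF.Fix.rec_eq]; rfl

theorem rename_app (s : Term) (t : Mono) (f : ℕ → ℕ) :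
    (app s t).rename f = app (s.rename f) (t.map fun a => a.rename f) := by
  simp only [rename, app, QPF.Fix.rec_eq]
  simp [Functor.map, Layer.map]

theorem rename_inl (s : Term) (f : ℕ → ℕ) : (inl s).rename f = inl (s.rename f) := by
  simp only [rename, inl, QPF.Fix.rec_eq]; rfl

theorem rename_inr (s : Term) (f : ℕ → ℕ) : (inr s).rename f = inr (s.rename f) := by
  simp only [rename, inr, QPF.Fix.rec_eq]; rfl

/-- Shift all free variables by one, to go under a binder. -/
noncomputable def shift (s : Term) : Term := s.rename Nat.succ

end Term

/-! ### Symmetric multilinear substitution -/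

/-- The two-element splittings `(I₁, I₂)` of a multiset can be iterated in any order. -/
theorem antidiagonal_bind_swap {A B : Type} (u : Multiset A)
    (h : Multiset A → Multiset A → Multiset A → Multiset B) :
    ((Multiset.antidiagonal u).bind fun p =>
        (Multiset.antidiagonal p.2).bind fun q => h p.1 q.1 q.2) =
      (Multiset.antidiagonal u).bind fun p =>
        (Multiset.antidiagonal p.2).bind fun q => h q.1 p.1 q.2 := by
  induction u using Multiset.induction generalizing h with
  | empty => simp
  | cons a u ih =>
    simp only [Multiset.antidiagonal_cons, Multiset.add_bind, Multiset.bind_map, Prod.map_fst,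
      Prod.map_snd, id_eq, Multiset.bind_add]
    rw [ih fun x y z => h x y (a ::ₘ z), ih fun x y z => h x (a ::ₘ y) z,
      ih fun x y z => h (a ::ₘ x) y z]
    abel

/-- Prepend one more factor to a function that distributes a multiset over several factors. -/
def distribStep (f : Mono → Sums Term) (G : Mono → Sums Mono) (u : Mono) : Sums Mono :=
  (Multiset.antidiagonal u).bind fun p => (f p.1).bind fun a => (G p.2).map fun t => a ::ₘ t

instance : LeftCommutative distribStep where
  left_comm f g G := by
    funext u
    simp only [distribStep, Multiset.map_bind, Multiset.map_map, Function.comp_def]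
    have key : ∀ (f g : Mono → Sums Term) (p : Mono × Mono),
        ((f p.1).bind fun a => (Multiset.antidiagonal p.2).bind fun q =>
            (g q.1).bind fun b => (G q.2).map fun t => a ::ₘ b ::ₘ t) =
          (Multiset.antidiagonal p.2).bind fun q =>
            (f p.1).bind fun a => (g q.1).bind fun b => (G q.2).map fun t => a ::ₘ b ::ₘ t := by
      intro f g p
      exact Multiset.bind_bind _ _
    simp only [key]
    rw [antidiagonal_bind_swap u fun x y z =>
      (f x).bind fun a => (g y).bind fun b => (G z).map fun t => a ::ₘ b ::ₘ t]
    refine Multiset.bind_congr fun p _ => Multiset.bind_congr fun q _ => ?_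
    rw [Multiset.bind_bind]
    simp only [Multiset.cons_swap]

/-- For `fs = [f₁, …, f_k]` and `u = [u₁, …, u_n]`, the sum of the monomials
`[f₁ u_{I₁}, …, f_k u_{I_k}]` (extended linearly) over all `k`-tuples `(I₁, …, I_k)` of pairwise
disjoint, possibly empty, sets with union `{1, …, n}`.  The tuple is chosen one set at a time,
`Multiset.antidiagonal` counting every splitting in two with its multiplicity. -/
noncomputable def distrib (fs : Multiset (Mono → Sums Term)) : Mono → Sums Mono :=
  open Classical in
  fs.foldr distribStep fun u => if u = 0 then {0} else 0

namespace Term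

/-- `s.nsubst x u` is `∂ₓ s · u`, the symmetric `n`-linear substitution of `u = [u₁, …, u_n]` for
the variable `x` in `s`.  The variable `x` disappears, so larger indices are lowered by one. -/
noncomputable def nsubst : Term → ℕ → Mono → Sums Term :=
  open Classical in
  QPF.Fix.rec fun l : Layer (ℕ → Mono → Sums Term) =>
    match l with
    | .var y => fun x u =>
        if y = x then (if Multiset.card u = 1 then u else 0)
        else if u = 0 then {var (if x < y then y - 1 else y)} else 0
    | .lam s => fun x u => (s (x + 1) (u.map shift)).map lam
    | .app s t => fun x u => (Multiset.antidiagonal u).bind fun p =>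
        (s x p.1).bind fun s' => (distrib (t.map fun a => a x) p.2).map fun t' => app s' t'
    | .inl s => fun x u => (s x u).map inl
    | .inr s => fun x u => (s x u).map inr

end Term

/-- Symmetric multilinear substitution in a monomial. -/
noncomputable def Mono.nsubst (t : Mono) (x : ℕ) (u : Mono) : Sums Mono :=
  distrib (t.map fun a => Term.nsubst a x) u

namespace Term

theorem nsubst_var_self_singleton (x : ℕ) (a : Term) : (var x).nsubst x {a} = {a} := by
  simp only [nsubst, var, QPF.Fix.rec_eq]
  simp [Functor.map, Layer.map]

open Classical in
theorem nsubst_var (y x : ℕ) (u : Mono) :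
    (var y).nsubst x u =
      if y = x then (if Multiset.card u = 1 then u else 0)
      else if u = 0 then {var (if x < y then y - 1 else y)} else 0 := by
  simp only [nsubst, var, QPF.Fix.rec_eq]
  simp [Functor.map, Layer.map]

theorem nsubst_lam (s : Term) (x : ℕ) (u : Mono) :
    (lam s).nsubst x u = (s.nsubst (x + 1) (u.map shift)).map lam := by
  simp only [nsubst, lam, QPF.Fix.rec_eq]; rfl

theorem nsubst_app (s : Term) (t : Mono) (x : ℕ) (u : Mono) :
    (app s t).nsubst x u = (Multiset.antidiagonal u).bind fun p =>
      (s.nsubst x p.1).bind fun s' => (Mono.nsubst t x p.2).map fun t' => app s' t' := by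
  simp only [nsubst, app, QPF.Fix.rec_eq]
  simp [Functor.map, Layer.map, app, Mono.nsubst, nsubst]

theorem nsubst_inl (s : Term) (x : ℕ) (u : Mono) :
    (inl s).nsubst x u = (s.nsubst x u).map inl := by
  simp only [nsubst, inl, QPF.Fix.rec_eq]; rfl

theorem nsubst_inr (s : Term) (x : ℕ) (u : Mono) :
    (inr s).nsubst x u = (s.nsubst x u).map inr := by
  simp only [nsubst, inr, QPF.Fix.rec_eq]; rfl

end Term

open Classical in
theorem Mono.nsubst_zero (x : ℕ) (u : Mono) :
    Mono.nsubst 0 x u = if u = 0 then {0} else 0 := by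
  simp [Mono.nsubst, distrib]

theorem Mono.nsubst_cons (a : Term) (t : Mono) (x : ℕ) (u : Mono) :
    Mono.nsubst (a ::ₘ t) x u = (Multiset.antidiagonal u).bind fun p =>
      (a.nsubst x p.1).bind fun a' => (Mono.nsubst t x p.2).map fun t' => a' ::ₘ t' := by
  simp [Mono.nsubst, distrib, distribStep]

/-! ### Reduction and normal forms -/

/-- One reduction step from a term to a finite sum of terms; syntactic constructs are extended to
sums by linearity, through `Multiset.map`. -/
inductive Term.Red : Term → Sums Term → Prop
  | beta (s : Term) (t : Mono) : Red (.app (.lam s) t) (s.nsubst 0 t)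
  | app_inl (s : Term) (t : Mono) : Red (.app (.inl s) t) {.inl (.app s t)}
  | app_inr (s : Term) (t : Mono) : Red (.app (.inr s) t) {.inr (.app s t)}
  | lam_inl (s : Term) : Red (.lam (.inl s)) {.inl (.lam s)}
  | lam_inr (s : Term) : Red (.lam (.inr s)) {.inr (.lam s)}
  | lam {s : Term} {S : Sums Term} (h : Red s S) : Red (.lam s) (S.map .lam)
  | app_left {s : Term} {S : Sums Term} (t : Mono) (h : Red s S) :
      Red (.app s t) (S.map fun s' => .app s' t)
  | app_right {s : Term} {S : Sums Term} (r : Term) (t : Mono) (h : Red s S) :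
      Red (.app r (s ::ₘ t)) (S.map fun s' => .app r (s' ::ₘ t))
  | inl {s : Term} {S : Sums Term} (h : Red s S) : Red (.inl s) (S.map .inl)
  | inr {s : Term} {S : Sums Term} (h : Red s S) : Red (.inr s) (S.map .inr)

/-- One reduction step from a monomial to a finite sum of monomials: `[s] · t` reduces to
`[S] · t` if `s` reduces to `S`. -/
inductive Mono.Red : Mono → Sums Mono → Prop
  | mk {s : Term} {S : Sums Term} (t : Mono) (h : Term.Red s S) :
      Red (s ::ₘ t) (S.map fun s' => s' ::ₘ t)

section Sums

variable {X : Type}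

/-- The extension of a reduction `r` to sums: `e + F` reduces to `E' + F` if `e` reduces to `E'`. -/
inductive SumRed (r : X → Sums X → Prop) : Sums X → Sums X → Prop
  | mk {e : X} {E' : Sums X} (F : Sums X) (h : r e E') : SumRed r ({e} + F) (E' + F)

/-- `N` is a normal form of `E`: it is reached from `E` in finitely many steps and it does not
reduce. -/
def IsNF (r : X → Sums X → Prop) (E N : Sums X) : Prop :=
  Relation.ReflTransGen (SumRed r) E N ∧ ∀ N', ¬ SumRed r N N'

open Classical in
/-- The normal form of `E` (with the value `0` if there were none). -/
noncomputable def nf (r : X → Sums X → Prop) (E : Sums X) : Sums X :=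
  if h : ∃ N, IsNF r E N then h.choose else 0

open Classical in
/-- The coefficient of `e` in `E`. -/
noncomputable def coeff (E : Sums X) (e : X) : ℕ := E.count e

/-- The support of `E`. -/
def supp (E : Sums X) : Set X := {e | coeff E e ≠ 0}

end Sums

/-- `NF(s)` for a term `s`. -/
noncomputable def Term.NF (s : Term) : Sums Term := nf Term.Red {s}

/-- `NF(t)` for a monomial `t`. -/
noncomputable def Mono.NF (t : Mono) : Sums Mono := nf Mono.Red {t}

/-! ### Coherence -/

/-- Coherence of terms.  The premise of `app` on the monomials `t`, `t'` is their coherence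
`Mono.Coh` below, spelled out. -/
inductive Term.Coh : Term → Term → Prop
  | var (n : ℕ) : Coh (.var n) (.var n)
  | lam {s s' : Term} (h : Coh s s') : Coh (.lam s) (.lam s')
  | app {s s' : Term} {t t' : Mono} (h : Coh s s')
      (ht : ∀ a ∈ t + t', ∀ b ∈ t + t', Coh a b) : Coh (.app s t) (.app s' t')
  | inl {s s' : Term} (h : Coh s s') : Coh (.inl s) (.inl s')
  | inr {s s' : Term} (h : Coh s s') : Coh (.inr s) (.inr s')
  | inl_inr (s s' : Term) : Coh (.inl s) (.inr s')
  | inr_inl (s s' : Term) : Coh (.inr s) (.inl s')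

/-- Coherence of monomials: all terms of `t · t'` are pairwise coherent. -/
def Mono.Coh (t t' : Mono) : Prop := ∀ a ∈ t + t', ∀ b ∈ t + t', Term.Coh a b

/-! ### Multiplicity coefficients -/

open Classical in
/-- The product of `n_i ! * w(a_i) ^ n_i` for a multiset `a₁^{n₁} ⋯ a_k^{n_k}` with pairwise
distinct `a_i`. -/
noncomputable def multProd {A : Type} (w : A → ℕ) (t : Multiset A) : ℕ :=
  ∏ a ∈ t.toFinset, (t.count a).factorial * w a ^ t.count a

namespace Term

/-- The pair of `s` and `m(s)`, by recursion on `s`. -/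
noncomputable def multPair : Term → Term × ℕ :=
  QPF.Fix.rec fun l : Layer (Term × ℕ) =>
    (QPF.Fix.mk (Layer.map Prod.fst l),
      match l with
      | .var _ => 1
      | .lam s => s.2
      | .app s t => s.2 * multProd Prod.snd t
      | .inl s => s.2
      | .inr s => s.2)

/-- The multiplicity coefficient `m(s)` of a term. -/
noncomputable def mult (s : Term) : ℕ := (multPair s).2

end Term

/-- The multiplicity coefficient `m(t)` of a monomial. -/
noncomputable def Mono.mult (t : Mono) : ℕ := multProd Term.mult t

theorem multProd_map {A B : Type} (f : A → B) (hf : Function.Injective f) (w : B → ℕ)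
    (t : Multiset A) : multProd w (t.map f) = multProd (fun a => w (f a)) t := by
  classical
  unfold multProd
  have h : (t.map f).toFinset = t.toFinset.image f := by ext; simp
  rw [h, Finset.prod_image fun a _ b _ hab => hf hab]
  refine Finset.prod_congr rfl fun a _ => ?_
  have h2 := Multiset.count_map_eq_count' f t hf a
  convert rfl using 2 <;> simp only [← h2]

namespace Term

theorem multPair_fst (s : Term) : (multPair s).1 = s := by
  have h : (fun s => (multPair s).1) = (id : Term → Term) := by
    funext s
    refine QPF.Fix.ind_rec (fun s => (multPair s).1) id ?_ s
    intro x hx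
    simp only [id_eq]
    rw [multPair, QPF.Fix.rec_eq]
    change QPF.Fix.mk (Prod.fst <$> multPair <$> x) = _
    rw [← QPF.comp_map]
    change QPF.Fix.mk ((fun s => (multPair s).1) <$> x) = _
    rw [hx, QPF.id_map]
  exact congrFun h s

theorem mult_var (n : ℕ) : (var n).mult = 1 := by
  simp only [mult, multPair, var, QPF.Fix.rec_eq]; rfl

theorem mult_lam (s : Term) : (lam s).mult = s.mult := by
  simp only [mult, multPair, lam, QPF.Fix.rec_eq]; rfl

theorem mult_app (s : Term) (t : Mono) : (app s t).mult = s.mult * Mono.mult t := by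
  have hinj : Function.Injective multPair := fun a b h => by
    rw [← multPair_fst a, h, multPair_fst]
  have h : (app s t).mult = (multPair s).2 * multProd Prod.snd (t.map multPair) := by
    simp only [mult, multPair, app, QPF.Fix.rec_eq]; rfl
  rw [h, multProd_map multPair hinj]
  rfl

theorem mult_inl (s : Term) : (inl s).mult = s.mult := by
  simp only [mult, multPair, inl, QPF.Fix.rec_eq]; rfl

theorem mult_inr (s : Term) : (inr s).mult = s.mult := by
  simp only [mult, multPair, inr, QPF.Fix.rec_eq]; rfl

end Term

end Resource

namespace Resource

namespace Term

/-! Normal forms. Every reduction step produces only terms of smaller `weight`, and two one-step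
reducts of a term are joinable (`red_locallyConfluent`). Since the summands of a sum reduce
independently, Newman's argument (`exists_converges`) then gives every term exactly one normal form.
The delicate critical pairs oppose a β-step to a step inside its body or its arguments. They close
because substitution respects reduction on both sides (`Red.nsubst`, `nsubst_cons_reds`); when the
inner step is itself a β-step, this amounts to the commutation of two successive substitutions,
`substComm_nsubst`.

Coefficients. The formula is proved as `coeff E e * m(e) = m(s)`, a form that composes: if `s` gives
`a` with coefficient `m(s)/m(a)` and `a` gives `e` with coefficient `m(a)/m(e)`, the product is
`m(s)/m(e)`. It is the whole coefficient provided that `e` comes from a single `a`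
(`coeff_bind_of_unique`). Uniformity ensures this: operations on coherent expressions have coherent
results, and they share a result only if the expressions are equal. For substitution these facts are
`Coh.nsubst` and `coeff_nsubst`. There the factorials in `m` cancel against the multiplicity of a
splitting of a multiset, which is a product of binomials (`coeff_antidiagonal_mul`), and against the
number of ways to match the elements of a monomial with their images (`coeff_distrib`).

A single step does not preserve uniformity: reducing one copy of `s` in `[s, s]` separates it from
the other. The formula is therefore transported along `develop`, which contracts redexes everywhere
at once. It preserves coherence and separates coherent terms (`Coh.develop`), has the right
coefficients (`coeff_develop`), consists of genuine reductions (`reds_develop`) and lowers the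
weight of every reducible term (`weight_lt_of_mem_develop`). Induction on the weight extends this to
normal forms (`Coh.NF`, `coeff_NF`).

A monomial `t` is treated through the term `⟨x⟩ t`, whose reductions are exactly those of `t` and
whose multiplicity is that of `t`. -/

theorem ind {P : Term → Prop} (hvar : ∀ n, P (var n)) (hlam : ∀ s, P s → P (lam s))
    (happ : ∀ s t, P s → (∀ a ∈ t, P a) → P (app s t)) (hinl : ∀ s, P s → P (inl s))
    (hinr : ∀ s, P s → P (inr s)) (s : Term) : P s := by
  refine QPF.Fix.ind P ?_ s
  rintro x ⟨u, rfl⟩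
  cases u with
  | var n => exact hvar n
  | lam s => exact hlam _ s.2
  | app s t =>
    refine happ _ _ s.2 fun a ha => ?_
    obtain ⟨b, -, rfl⟩ := Multiset.mem_map.1 ha
    exact b.2
  | inl s => exact hinl _ s.2
  | inr s => exact hinr _ s.2

/-! ### Injectivity and disjointness of the constructors -/

theorem mk_injective : Function.Injective (QPF.Fix.mk (F := Layer)) :=
  Function.LeftInverse.injective QPF.Fix.dest_mk

@[simp] theorem var_inj {m n : ℕ} : var m = var n ↔ m = n := by
  simp [var, mk_injective.eq_iff]
@[simp] theorem lam_inj {s s' : Term} : lam s = lam s' ↔ s = s' := by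
  simp [lam, mk_injective.eq_iff]
@[simp] theorem app_inj {s s' : Term} {t t' : Mono} :
    app s t = app s' t' ↔ s = s' ∧ t = t' := by
  simp [app, mk_injective.eq_iff]
@[simp] theorem inl_inj {s s' : Term} : inl s = inl s' ↔ s = s' := by
  simp [inl, mk_injective.eq_iff]
@[simp] theorem inr_inj {s s' : Term} : inr s = inr s' ↔ s = s' := by
  simp [inr, mk_injective.eq_iff]

@[simp] theorem var_ne_lam {n : ℕ} {s : Term} : var n ≠ lam s := by
  simp [var, lam, mk_injective.eq_iff]
@[simp] theorem var_ne_app {n : ℕ} {s : Term} {t : Mono} : var n ≠ app s t := by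
  simp [var, app, mk_injective.eq_iff]
@[simp] theorem var_ne_inl {n : ℕ} {s : Term} : var n ≠ inl s := by
  simp [var, inl, mk_injective.eq_iff]
@[simp] theorem var_ne_inr {n : ℕ} {s : Term} : var n ≠ inr s := by
  simp [var, inr, mk_injective.eq_iff]
@[simp] theorem lam_ne_var {n : ℕ} {s : Term} : lam s ≠ var n := var_ne_lam.symm
@[simp] theorem lam_ne_app {s s' : Term} {t : Mono} : lam s ≠ app s' t := by
  simp [lam, app, mk_injective.eq_iff]
@[simp] theorem lam_ne_inl {s s' : Term} : lam s ≠ inl s' := by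
  simp [lam, inl, mk_injective.eq_iff]
@[simp] theorem lam_ne_inr {s s' : Term} : lam s ≠ inr s' := by
  simp [lam, inr, mk_injective.eq_iff]
@[simp] theorem app_ne_var {n : ℕ} {s : Term} {t : Mono} : app s t ≠ var n := var_ne_app.symm
@[simp] theorem app_ne_lam {s s' : Term} {t : Mono} : app s t ≠ lam s' := lam_ne_app.symm
@[simp] theorem app_ne_inl {s s' : Term} {t : Mono} : app s t ≠ inl s' := by
  simp [app, inl, mk_injective.eq_iff]
@[simp] theorem app_ne_inr {s s' : Term} {t : Mono} : app s t ≠ inr s' := by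
  simp [app, inr, mk_injective.eq_iff]
@[simp] theorem inl_ne_var {n : ℕ} {s : Term} : inl s ≠ var n := var_ne_inl.symm
@[simp] theorem inl_ne_lam {s s' : Term} : inl s ≠ lam s' := lam_ne_inl.symm
@[simp] theorem inl_ne_app {s s' : Term} {t : Mono} : inl s ≠ app s' t := app_ne_inl.symm
@[simp] theorem inl_ne_inr {s s' : Term} : inl s ≠ inr s' := by
  simp [inl, inr, mk_injective.eq_iff]
@[simp] theorem inr_ne_var {n : ℕ} {s : Term} : inr s ≠ var n := var_ne_inr.symm
@[simp] theorem inr_ne_lam {s s' : Term} : inr s ≠ lam s' := lam_ne_inr.symm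
@[simp] theorem inr_ne_app {s s' : Term} {t : Mono} : inr s ≠ app s' t := app_ne_inr.symm
@[simp] theorem inr_ne_inl {s s' : Term} : inr s ≠ inl s' := inl_ne_inr.symm

/-! ### Renamings -/

theorem liftRen_comp (f g : ℕ → ℕ) : liftRen (g ∘ f) = liftRen g ∘ liftRen f := by
  funext n; cases n <;> rfl

theorem rename_rename (s : Term) :
    ∀ f g : ℕ → ℕ, (s.rename f).rename g = s.rename (g ∘ f) := by
  induction s using ind with
  | hvar n => simp [rename_var]
  | hlam s ih => simp [rename_lam, ih, liftRen_comp]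
  | happ s t ih iht =>
    intro f g
    simp only [rename_app, ih, Multiset.map_map, Function.comp_apply]
    rw [Multiset.map_congr rfl fun a ha => iht a ha f g]
  | hinl s ih => simp [rename_inl, ih]
  | hinr s ih => simp [rename_inr, ih]

theorem shift_rename (s : Term) (f : ℕ → ℕ) :
    (shift s).rename (liftRen f) = shift (s.rename f) := by
  simp only [shift, rename_rename]; rfl

theorem liftRen_injective {f : ℕ → ℕ} (hf : Function.Injective f) :
    Function.Injective (liftRen f) := by
  rintro (_ | m) (_ | n) h <;> simp [liftRen] at h ⊢
  exact hf h

/-- The renaming that makes room for the variable `x`. -/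
def skip (x n : ℕ) : ℕ := if n < x then n else n + 1

theorem liftRen_skip (x : ℕ) : liftRen (skip x) = skip (x + 1) := by
  funext n
  cases n with
  | zero => simp [liftRen, skip]
  | succ n => simp only [liftRen, skip]; grind

theorem skip_zero : skip 0 = Nat.succ := by
  funext n; simp [skip]

theorem skip_ne (x n : ℕ) : skip x n ≠ x := by
  unfold skip; grind

theorem exists_eq_skip {x y : ℕ} (h : y ≠ x) : ∃ n, y = skip x n := by
  refine ⟨if x < y then y - 1 else y, ?_⟩
  unfold skip; grind

theorem unskip_skip (x n : ℕ) : (if x < skip x n then skip x n - 1 else skip x n) = n := by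
  unfold skip; grind

end Term

/-! ### Convolution -/

section Conv

variable {M α β γ δ ε : Type}

/-- The lifting of a binary operation to functions that consume a multiset. -/
def conv (h : α → β → γ) (f : Multiset M → Multiset α) (g : Multiset M → Multiset β)
    (u : Multiset M) : Multiset γ :=
  (Multiset.antidiagonal u).bind fun p => (f p.1).bind fun a => (g p.2).map (h a)

open Classical in
/-- The function consuming the empty multiset only, with value `a`. -/
noncomputable def unit (a : α) (u : Multiset M) : Multiset α := if u = 0 then {a} else 0

@[simp] theorem unit_zero (a : α) : unit a (0 : Multiset M) = {a} := by simp [unit]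

theorem unit_of_ne (a : α) {u : Multiset M} (h : u ≠ 0) : unit a u = 0 := by simp [unit, h]

theorem mem_unit {a b : α} {u : Multiset M} : b ∈ unit a u ↔ u = 0 ∧ b = a := by
  by_cases h : u = 0 <;> simp [unit, h]

theorem map_unit (f : α → β) (a : α) (u : Multiset M) : (unit a u).map f = unit (f a) u := by
  by_cases h : u = 0 <;> simp [unit, h]

theorem mem_conv {h : α → β → γ} {f : Multiset M → Multiset α} {g : Multiset M → Multiset β}
    {u : Multiset M} {c : γ} :
    c ∈ conv h f g u ↔ ∃ v w a b, v + w = u ∧ a ∈ f v ∧ b ∈ g w ∧ h a b = c := by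
  simp only [conv, Multiset.mem_bind, Multiset.mem_antidiagonal, Prod.exists, Multiset.mem_map]
  constructor
  · rintro ⟨v, w, hu, a, ha, b, hb, rfl⟩
    exact ⟨v, w, a, b, hu, ha, hb, rfl⟩
  · rintro ⟨v, w, a, b, hu, ha, hb, rfl⟩
    exact ⟨v, w, hu, a, ha, b, hb, rfl⟩

theorem antidiagonal_map {N : Type} (φ : M → N) (u : Multiset M) :
    (u.map φ).antidiagonal = u.antidiagonal.map (Prod.map (Multiset.map φ) (Multiset.map φ)) := by
  induction u using Multiset.induction with
  | empty => simp
  | cons a u ih =>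
    simp only [Multiset.map_cons, Multiset.antidiagonal_cons, ih, Multiset.map_add,
      Multiset.map_map]
    congr 1 <;> exact Multiset.map_congr rfl fun ⟨p, q⟩ _ => by simp

theorem conv_map_arg {N : Type} (h : α → β → γ) (f : Multiset N → Multiset α)
    (g : Multiset N → Multiset β) (φ : M → N) (u : Multiset M) :
    conv h f g (u.map φ) = conv h (fun v => f (v.map φ)) (fun v => g (v.map φ)) u := by
  simp [conv, antidiagonal_map, Multiset.bind_map]

theorem map_conv (ψ : γ → δ) (h : α → β → γ) (f : Multiset M → Multiset α)
    (g : Multiset M → Multiset β) (u : Multiset M) :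
    (conv h f g u).map ψ = conv (fun a b => ψ (h a b)) f g u := by
  simp [conv, Multiset.map_bind]

theorem conv_map_map (h : γ → δ → ε) (ψ : α → γ) (χ : β → δ) (f : Multiset M → Multiset α)
    (g : Multiset M → Multiset β) (u : Multiset M) :
    conv h (fun v => (f v).map ψ) (fun v => (g v).map χ) u =
      conv (fun a b => h (ψ a) (χ b)) f g u := by
  simp [conv, Multiset.bind_map]

theorem conv_zero (h : α → β → γ) (f : Multiset M → Multiset α) (g : Multiset M → Multiset β) :
    conv h f g 0 = (f 0).bind fun a => (g 0).map (h a) := by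
  simp [conv]

/-- A Leibniz rule: the extra element is consumed by exactly one of the two functions. -/
theorem conv_cons (h : α → β → γ) (f : Multiset M → Multiset α) (g : Multiset M → Multiset β)
    (m : M) (u : Multiset M) :
    conv h f g (m ::ₘ u) =
      conv h f (fun v => g (m ::ₘ v)) u + conv h (fun v => f (m ::ₘ v)) g u := by
  simp [conv, Multiset.bind_map]

theorem conv_unit_unit (h : α → β → γ) (a : α) (b : β) (u : Multiset M) :
    conv h (unit a) (unit b) u = unit (h a b) u := by
  classical
  by_cases hu : u = 0
  · simp [hu, conv_zero]
  · rw [unit_of_ne _ hu, Multiset.eq_zero_iff_forall_notMem]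
    intro c hc
    obtain ⟨v, w, a', b', hvw, ha, hb, rfl⟩ := mem_conv.1 hc
    rw [mem_unit] at ha hb
    exact hu (by simp [← hvw, ha.1, hb.1])

end Conv

/-! ### Substitution as a convolution -/

namespace Term

theorem nsubst_var_self (x : ℕ) (u : Mono) :
    (var x).nsubst x u = if u.card = 1 then u else 0 := by
  simp [nsubst_var]

/-- The variables other than `x` are exactly the values of `skip x`, so writing them in this form
replaces the lowering of indices by an inverse image. -/
theorem nsubst_var_skip (x n : ℕ) : (var (skip x n)).nsubst x = unit (var n) := by
  funext u
  rw [nsubst_var, if_neg (skip_ne x n), unskip_skip]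
  by_cases h : u = 0 <;> simp [unit, h]

/-- Application and the adjunction of an element to a monomial both substitute by convolution, so
that a property of `conv` serves the two cases at once. -/
theorem nsubst_app_eq_conv (s : Term) (t : Mono) (x : ℕ) :
    (app s t).nsubst x = conv app (s.nsubst x) (Mono.nsubst t x) :=
  funext fun u => nsubst_app s t x u

end Term

theorem Mono.nsubst_zero_eq_unit (x : ℕ) : Mono.nsubst 0 x = unit 0 := by
  funext u
  rw [Mono.nsubst_zero]
  by_cases h : u = 0 <;> simp [unit, h]

theorem Mono.nsubst_cons_eq_conv (a : Term) (t : Mono) (x : ℕ) :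
    Mono.nsubst (a ::ₘ t) x = conv (· ::ₘ ·) (a.nsubst x) (Mono.nsubst t x) :=
  funext fun u => Mono.nsubst_cons a t x u

/-- Renaming in a monomial. -/
noncomputable def Mono.rename (t : Mono) (f : ℕ → ℕ) : Mono := t.map fun a => a.rename f

namespace Term

theorem map_shift_rename (u : Mono) (f : ℕ → ℕ) :
    (u.map shift).map (fun a => a.rename (liftRen f)) =
      (u.map fun a => a.rename f).map shift := by
  simp [Multiset.map_map, shift_rename]

/-- The statement for monomials takes the one for their elements as a hypothesis, so that it can be
used inside the induction on terms, in the application case. -/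
theorem nsubst_rename_mono {x x' : ℕ} {f f' : ℕ → ℕ} (t : Mono)
    (ih : ∀ a ∈ t, ∀ u : Mono, (a.nsubst x u).map (fun b => b.rename f) =
      (a.rename f').nsubst x' (u.map fun b => b.rename f)) (u : Mono) :
    (Mono.nsubst t x u).map (fun b => Mono.rename b f) =
      Mono.nsubst (t.map fun a => a.rename f') x' (u.map fun b => b.rename f) := by
  induction t using Multiset.induction generalizing u with
  | empty =>
    simp only [Multiset.map_zero, Mono.nsubst_zero_eq_unit, map_unit]
    by_cases h : u = 0 <;> simp [unit, h, Mono.rename]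
  | cons a t iht =>
    simp only [Multiset.map_cons, Mono.nsubst_cons_eq_conv, map_conv, conv_map_arg]
    simp only [← ih a (by simp), ← iht fun b hb => ih b (by simp [hb])]
    rw [conv_map_map]
    simp [Mono.rename]

/-- Substitution is natural with respect to renamings. -/
theorem nsubst_rename (s : Term) : ∀ (x x' : ℕ) (f f' : ℕ → ℕ) (u : Mono), f' x = x' →
    (∀ n, f' (skip x n) = skip x' (f n)) →
    (s.nsubst x u).map (fun a => a.rename f) =
      (s.rename f').nsubst x' (u.map fun a => a.rename f) := by
  induction s using ind with
  | hvar y =>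
    intro x x' f f' u hx hf
    rw [rename_var]
    by_cases hy : y = x
    · subst hy
      rw [hx, nsubst_var_self, nsubst_var_self, Multiset.card_map]
      split_ifs <;> simp
    · obtain ⟨n, rfl⟩ := exists_eq_skip hy
      rw [hf, nsubst_var_skip, nsubst_var_skip, map_unit, rename_var]
      by_cases h : u = 0 <;> simp [unit, h]
  | hlam s ih =>
    intro x x' f f' u hx hf
    rw [rename_lam, nsubst_lam, nsubst_lam, ← map_shift_rename,
      ← ih (x + 1) (x' + 1) (liftRen f) (liftRen f'), Multiset.map_map, Multiset.map_map]
    · simp [rename_lam]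
    · simp [liftRen, hx]
    · rintro (_ | n)
      · simp [skip, liftRen]
      · rw [← liftRen_skip, ← liftRen_skip]
        simp [liftRen, hf]
  | happ s t ih iht =>
    intro x x' f f' u hx hf
    rw [rename_app, nsubst_app_eq_conv, nsubst_app_eq_conv, map_conv, conv_map_arg]
    simp only [← ih x x' f f' _ hx hf,
      ← nsubst_rename_mono t fun a ha v => iht a ha x x' f f' v hx hf]
    rw [conv_map_map]
    simp [Mono.rename, rename_app]
  | hinl s ih =>
    intro x x' f f' u hx hf
    rw [rename_inl, nsubst_inl, nsubst_inl, ← ih x x' f f' u hx hf]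
    simp [rename_inl]
  | hinr s ih =>
    intro x x' f f' u hx hf
    rw [rename_inr, nsubst_inr, nsubst_inr, ← ih x x' f f' u hx hf]
    simp [rename_inr]

theorem nsubst_shift (s : Term) (x : ℕ) (u : Mono) :
    (s.nsubst x u).map shift = (shift s).nsubst (x + 1) (u.map shift) :=
  nsubst_rename s x (x + 1) Nat.succ Nat.succ u rfl fun n => by simp only [skip]; grind

theorem nsubst_shift_mono (t : Mono) (x : ℕ) (u : Mono) :
    (Mono.nsubst t x u).map (Multiset.map shift) =
      Mono.nsubst (t.map shift) (x + 1) (u.map shift) :=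
  nsubst_rename_mono t (fun a _ v => nsubst_shift a x v) u

theorem map_unit_shift {α : Type} (a : α) (u : Mono) :
    unit a (u.map shift) = unit a u := by
  by_cases h : u = 0 <;> simp [unit, h]

/-- Substitution for a variable that does not occur. -/
theorem nsubst_rename_skip (s : Term) : ∀ x, (s.rename (skip x)).nsubst x = unit s := by
  induction s using ind with
  | hvar y => simp [rename_var, nsubst_var_skip]
  | hlam s ih =>
    intro x
    funext u
    rw [rename_lam, nsubst_lam, liftRen_skip, ih, map_unit, map_unit_shift]
  | happ s t ih iht =>
    intro x
    have key : Mono.nsubst (t.map fun a => a.rename (skip x)) x = unit t := by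
      clear ih
      induction t using Multiset.induction with
      | empty => simp [Mono.nsubst_zero_eq_unit]
      | cons a t ih2 =>
        rw [Multiset.map_cons, Mono.nsubst_cons_eq_conv, iht a (by simp),
          ih2 fun b hb => iht b (by simp [hb])]
        funext u
        rw [conv_unit_unit]
    rw [rename_app, nsubst_app_eq_conv, ih, key]
    funext u
    rw [conv_unit_unit]
  | hinl s ih =>
    intro x
    funext u
    rw [rename_inl, nsubst_inl, ih, map_unit]
  | hinr s ih =>
    intro x
    funext u
    rw [rename_inr, nsubst_inr, ih, map_unit]

end Term

end Resource

namespace Resource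

/-! ### Iterated splittings of a multiset -/

section Split

variable {M α β γ δ : Type}

/-- The sum of `k v w` over all splittings of a multiset in two. -/
def split (u : Multiset M) (k : Multiset M → Multiset M → Multiset α) : Multiset α :=
  (Multiset.antidiagonal u).bind fun p => k p.1 p.2

theorem conv_eq_split (h : α → β → γ) (f : Multiset M → Multiset α)
    (g : Multiset M → Multiset β) (u : Multiset M) :
    conv h f g u = split u fun v w => (f v).bind fun a => (g w).map (h a) := rfl

theorem split_congr {u : Multiset M} {k k' : Multiset M → Multiset M → Multiset α}
    (h : ∀ v w, v + w = u → k v w = k' v w) : split u k = split u k' :=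
  Multiset.bind_congr fun _ hp => h _ _ (Multiset.mem_antidiagonal.1 hp)

theorem split_zero (k : Multiset M → Multiset M → Multiset α) : split 0 k = k 0 0 := by
  simp [split]

theorem split_cons (m : M) (u : Multiset M) (k : Multiset M → Multiset M → Multiset α) :
    split (m ::ₘ u) k = split u (fun v w => k v (m ::ₘ w)) + split u fun v w => k (m ::ₘ v) w := by
  simp [split, Multiset.bind_map]

theorem split_add (u : Multiset M) (k k' : Multiset M → Multiset M → Multiset α) :
    (split u fun v w => k v w + k' v w) = split u k + split u k' := by
  simp [split]

theorem split_map_arg {N : Type} (φ : M → N) (u : Multiset M)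
    (k : Multiset N → Multiset N → Multiset α) :
    split (u.map φ) k = split u fun v w => k (v.map φ) (w.map φ) := by
  simp [split, antidiagonal_map, Multiset.bind_map]

theorem split_bind (u : Multiset M) (k : Multiset M → Multiset M → Multiset α)
    (f : α → Multiset β) : (split u k).bind f = split u fun v w => (k v w).bind f :=
  Multiset.bind_assoc

theorem map_split (u : Multiset M) (k : Multiset M → Multiset M → Multiset α)
    (f : α → β) : (split u k).map f = split u fun v w => (k v w).map f :=
  Multiset.map_bind _ _ _

theorem bind_split (S : Multiset β) (u : Multiset M)
    (k : β → Multiset M → Multiset M → Multiset α) :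
    (S.bind fun b => split u (k b)) = split u fun v w => S.bind fun b => k b v w :=
  Multiset.bind_bind _ _

theorem split_comm {N : Type} (u : Multiset M) (t : Multiset N)
    (k : Multiset M → Multiset M → Multiset N → Multiset N → Multiset α) :
    (split u fun v w => split t (k v w)) = split t fun p q => split u fun v w => k v w p q :=
  Multiset.bind_bind _ _

/-- Both sides run over the distributions of `u` into three parts; in the induction, a new element
goes to one of the three. -/
theorem split_assoc (u : Multiset M)
    (k : Multiset M → Multiset M → Multiset M → Multiset α) :
    (split u fun v w => split v fun p q => k p q w) = split u fun v w => split w (k v) := by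
  induction u using Multiset.induction generalizing k with
  | empty => simp [split_zero]
  | cons a u ih =>
    simp only [split_cons, split_add]
    rw [ih fun x y z => k x y (a ::ₘ z), ih fun x y z => k x (a ::ₘ y) z,
      ih fun x y z => k (a ::ₘ x) y z, add_assoc]

theorem split_left_comm (u : Multiset M)
    (k : Multiset M → Multiset M → Multiset M → Multiset α) :
    (split u fun v w => split w fun p q => k v p q) =
      split u fun v w => split w fun p q => k p v q :=
  antidiagonal_bind_swap u k

/-- Four parts arranged in a square can be formed by rows or by columns. -/
theorem split_split_split_comm (u : Multiset M)
    (k : Multiset M → Multiset M → Multiset M → Multiset M → Multiset α) :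
    (split u fun a b => split a fun v w => split b fun v' w' => k v w v' w') =
      split u fun a b => split a fun v v' => split b fun w w' => k v w v' w' := by
  induction u using Multiset.induction generalizing k with
  | empty => simp [split_zero]
  | cons a u ih =>
    simp only [split_cons, split_add]
    rw [ih fun x y z w => k x y z (a ::ₘ w), ih fun x y z w => k x y (a ::ₘ z) w,
      ih fun x y z w => k x (a ::ₘ y) z w, ih fun x y z w => k (a ::ₘ x) y z w]
    abel

/-- Commutation of two successive substitutions, for functions that consume a multiset. -/
def SubstComm (K : Multiset M → Multiset M → Multiset (Multiset M))
    (F : Multiset M → Multiset α) (F' : α → Multiset M → Multiset β)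
    (G : Multiset M → Multiset γ) (G' : γ → Multiset M → Multiset β) : Prop :=
  ∀ t u, ((F t).bind fun a => F' a u) =
    split u fun v w => (G v).bind fun c => (K t w).bind fun T => G' c T

/-- Splitting commutes with the substitution `K` in a multiset. -/
def SplitComm (K : Multiset M → Multiset M → Multiset (Multiset M)) : Prop :=
  ∀ (A : Type) (t u : Multiset M) (k : Multiset M → Multiset M → Multiset A),
    ((K t u).bind fun T => split T k) =
      split t fun t₁ t₂ => split u fun u₁ u₂ =>
        (K t₁ u₁).bind fun T₁ => (K t₂ u₂).bind fun T₂ => k T₁ T₂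

/-- Commutation passes from two functions to their convolution. Expanding both sides distributes `u`
into four parts, according to the factor that receives an element and to whether it is substituted
directly or through an element of `t`. The two sides group these parts by rows and by columns. -/
theorem substComm_conv {K : Multiset M → Multiset M → Multiset (Multiset M)} (hK : SplitComm K)
    {α₁ β₁ γ₁ α₂ β₂ γ₂ α₃ β₃ γ₃ : Type}
    {F₁ : Multiset M → Multiset α₁} {F₁' : α₁ → Multiset M → Multiset β₁}
    {G₁ : Multiset M → Multiset γ₁} {G₁' : γ₁ → Multiset M → Multiset β₁}
    {F₂ : Multiset M → Multiset α₂} {F₂' : α₂ → Multiset M → Multiset β₂}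
    {G₂ : Multiset M → Multiset γ₂} {G₂' : γ₂ → Multiset M → Multiset β₂}
    (h₁ : SubstComm K F₁ F₁' G₁ G₁') (h₂ : SubstComm K F₂ F₂' G₂ G₂')
    {hα : α₁ → α₂ → α₃} {hβ : β₁ → β₂ → β₃} {hγ : γ₁ → γ₂ → γ₃}
    {F' : α₃ → Multiset M → Multiset β₃} {G' : γ₃ → Multiset M → Multiset β₃}
    (hF : ∀ a b, F' (hα a b) = conv hβ (F₁' a) (F₂' b))
    (hG : ∀ a b, G' (hγ a b) = conv hβ (G₁' a) (G₂' b)) :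
    SubstComm K (conv hα F₁ F₂) F' (conv hγ G₁ G₂) G' := by
  intro t u
  have e₁ : ((conv hα F₁ F₂ t).bind fun a => F' a u) =
      split t fun t₁ t₂ => split u fun u₁ u₂ =>
        ((F₁ t₁).bind fun a => F₁' a u₁).bind fun a' =>
          ((F₂ t₂).bind fun b => F₂' b u₂).map fun b' => hβ a' b' := by
    simp only [conv_eq_split, split_bind, Multiset.bind_assoc, Multiset.bind_map, hF, bind_split,
      Multiset.map_bind]
    refine split_congr fun t₁ t₂ _ => split_congr fun u₁ u₂ _ =>
      Multiset.bind_congr fun a _ => ?_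
    exact Multiset.bind_bind _ _
  have e₂ : (split u fun v w => (conv hγ G₁ G₂ v).bind fun c => (K t w).bind fun T => G' c T) =
      split u fun v w => split v fun v₁ v₂ => split t fun t₁ t₂ => split w fun w₁ w₂ =>
        (G₁ v₁).bind fun c => (G₂ v₂).bind fun d => (K t₁ w₁).bind fun T₁ =>
          (K t₂ w₂).bind fun T₂ => (G₁' c T₁).bind fun a' => (G₂' d T₂).map fun b' => hβ a' b' := by
    refine split_congr fun v w _ => ?_
    simp only [conv_eq_split, split_bind, Multiset.bind_assoc, Multiset.bind_map, hG, hK _ t w,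
      bind_split]
  rw [e₁, e₂]
  simp only [h₁ _ _, h₂ _ _, split_bind, map_split, bind_split, Multiset.bind_assoc,
    Multiset.map_bind]
  -- The interchange of the four parts of `u`, with the independent splitting of `t` moved to the
  -- front.
  have e₃ : ∀ k : Multiset M → Multiset M → Multiset M → Multiset M → Multiset M → Multiset M →
      Multiset β₃,
      (split u fun v w => split v fun v₁ v₂ => split t fun t₁ t₂ => split w fun w₁ w₂ =>
        k v₁ v₂ t₁ t₂ w₁ w₂) =
      split t fun t₁ t₂ => split u fun u₁ u₂ => split u₁ fun v₁ w₁ => split u₂ fun v₂ w₂ =>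
        k v₁ v₂ t₁ t₂ w₁ w₂ := by
    intro k
    refine (split_congr fun v w _ => split_comm v t _).trans ((split_comm u t _).trans ?_)
    exact split_congr fun t₁ t₂ _ =>
      split_split_split_comm u fun v₁ v₂ w₁ w₂ => k v₁ v₂ t₁ t₂ w₁ w₂
  rw [e₃]
  refine split_congr fun t₁ t₂ _ => split_congr fun u₁ u₂ _ => ?_
  rw [split_comm u₂ u₁]
  refine split_congr fun v₁ w₁ _ => split_congr fun v₂ w₂ _ => Multiset.bind_congr fun c _ => ?_
  rw [Multiset.bind_bind (G₂ v₂)]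
  refine Multiset.bind_congr fun T₁ _ => ?_
  rw [Multiset.bind_bind]
  simp only [Multiset.bind_bind (G₁' c T₁)]

/-- Only the splitting whose left part is empty contributes. -/
theorem split_unit_left (a : β) (u : Multiset M) (k : β → Multiset M → Multiset α) :
    (split u fun v w => (unit a v).bind fun b => k b w) = k a u := by
  induction u using Multiset.induction generalizing k with
  | empty => simp [split_zero]
  | cons m u ih =>
    rw [split_cons, ih fun b w => k b (m ::ₘ w)]
    simp [unit_of_ne, split]

theorem bind_singleton_self (S : Multiset α) : (S.bind fun a => {a}) = S := by
  rw [Multiset.bind_singleton, Multiset.map_id']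

theorem split_unit_right (u : Multiset M) (k : Multiset M → Multiset α) :
    (split u fun v w => (k v).bind fun a => unit a w) = k u := by
  induction u using Multiset.induction generalizing k with
  | empty => simp [split_zero, bind_singleton_self]
  | cons m u ih =>
    rw [split_cons, ih fun v => k (m ::ₘ v)]
    simp [unit_of_ne, split]

end Split

/-! ### Substitution in monomials -/

namespace Mono

theorem card_of_mem_nsubst {t : Mono} {x : ℕ} {u T : Mono} (h : T ∈ t.nsubst x u) :
    T.card = t.card := by
  induction t using Multiset.induction generalizing u T with
  | empty =>
    rw [nsubst_zero_eq_unit, mem_unit] at h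
    simp [h.2]
  | cons a t ih =>
    rw [nsubst_cons_eq_conv, mem_conv] at h
    obtain ⟨v, w, b, T, -, -, hT, rfl⟩ := h
    simp [ih hT]

theorem nsubst_singleton (a : Term) (x : ℕ) (u : Mono) :
    Mono.nsubst {a} x u = (a.nsubst x u).map fun b => {b} := by
  rw [← Multiset.cons_zero, nsubst_cons_eq_conv, conv_eq_split, nsubst_zero_eq_unit]
  have h := split_unit_right u fun v => (a.nsubst x v).map fun b => ({b} : Mono)
  simpa [Multiset.bind_map, map_unit] using h

/-- Substitution in a monomial preserves its size, so both sides vanish unless `t` and `u` are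
empty. -/
theorem nsubst_bind_unit {α : Type} (t : Mono) (x : ℕ) (u : Mono) (a : α) :
    (t.nsubst x u).bind (unit a) = (unit a t).bind fun a => unit a u := by
  rcases eq_or_ne t 0 with rfl | ht
  · rw [nsubst_zero_eq_unit]
    by_cases h : u = 0 <;> simp [unit, h]
  · rw [unit_of_ne _ ht, Multiset.zero_bind, Multiset.eq_zero_iff_forall_notMem]
    intro b hb
    obtain ⟨T, hT, hb⟩ := Multiset.mem_bind.1 hb
    have h := card_of_mem_nsubst hT
    rw [(mem_unit.1 hb).1, Multiset.card_zero] at h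
    exact ht (Multiset.card_eq_zero.1 h.symm)

/-- Each element of a monomial carries along the terms substituted into it. In the induction the
image of the new element falls in the right or in the left part, and its share of `u` is moved
accordingly, by `split_left_comm` or `split_assoc`. -/
theorem splitComm_nsubst (x : ℕ) : SplitComm fun t u => Mono.nsubst t x u := by
  intro A t
  induction t using Multiset.induction with
  | empty =>
    intro u k
    simp only [nsubst_zero_eq_unit, split_zero]
    rw [split_unit_left 0 u fun T w => (unit 0 w).bind fun T₂ => k T T₂]
    by_cases h : u = 0 <;> simp [unit, h, split_zero]
  | cons a t ih =>
    intro u k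
    rw [split_cons]
    simp only [nsubst_cons_eq_conv, conv_eq_split, split_bind, Multiset.bind_assoc,
      Multiset.bind_map, split_cons, Multiset.bind_add, split_add, ih, bind_split]
    congr 1
    · rw [split_comm t u]
      simp only [fun w => split_comm (α := A) t w]
      rw [split_left_comm]
      refine split_congr fun v w _ => split_congr fun p q _ => split_congr fun t₁ t₂ _ => ?_
      rw [Multiset.bind_bind]
    · rw [split_comm t u]
      simp only [fun w => split_comm (α := A) t w]
      rw [split_assoc]

end Mono

/-! ### Commutation of two successive substitutions -/

namespace Term

theorem skip_skip {x y : ℕ} (h : x ≤ y) (n : ℕ) :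
    skip x (skip y n) = skip (y + 1) (skip x n) := by
  unfold skip; grind

/-- Commutation of successive substitutions for the variables `x` and `y + 1`. -/
theorem substComm_nsubst (s : Term) : ∀ x y, x ≤ y →
    SubstComm (fun t u => Mono.nsubst t y u) (s.nsubst x) (fun a => a.nsubst y)
      (fun v => s.nsubst (y + 1) (v.map fun a => a.rename (skip x))) fun a => a.nsubst x := by
  induction s using ind with
  | hvar z =>
    intro x y hxy t u
    have hmap : ∀ (a : Term) (v : Mono), unit a (v.map fun b => b.rename (skip x)) = unit a v := by
      intro a v
      by_cases h : v = 0 <;> simp [unit, h]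
    by_cases hz : z = x
    · subst hz
      -- As `z ≤ y`, the variable `z` differs from `y + 1` and keeps its index when `y + 1` is
      -- removed.
      have e : z = skip (y + 1) z := by unfold skip; grind
      have e' : (var z).nsubst (y + 1) = unit (var z) := by
        conv_lhs => rw [e]
        exact nsubst_var_skip _ _
      simp only [e', hmap]
      rw [split_unit_left (var z) u fun c w => (Mono.nsubst t y w).bind fun T => c.nsubst z T]
      simp only [nsubst_var_self]
      by_cases ht : t.card = 1
      · obtain ⟨a, rfl⟩ := Multiset.card_eq_one.1 ht
        simp [Mono.nsubst_singleton, Multiset.bind_map, bind_singleton_self]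
      · rw [if_neg ht, Multiset.zero_bind, eq_comm, Multiset.eq_zero_iff_forall_notMem]
        intro b hb
        obtain ⟨T, hT, hb⟩ := Multiset.mem_bind.1 hb
        rw [Mono.card_of_mem_nsubst hT, if_neg ht] at hb
        simp at hb
    · obtain ⟨n, rfl⟩ := exists_eq_skip hz
      simp only [nsubst_var_skip]
      by_cases hn : n = y
      · subst hn
        -- The variable is the one that the second substitution replaces. It contains no `x`, and
        -- neither do the renamed terms put in its place, so both sides vanish unless `t` is empty.
        have e : skip x n = n + 1 := by unfold skip; grind
        simp only [e, nsubst_var_self, Multiset.card_map]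
        have e₂ : ∀ v w : Mono, ((if v.card = 1 then v.map fun a => a.rename (skip x) else 0).bind
            fun c => (Mono.nsubst t n w).bind fun T => c.nsubst x T) =
            (if v.card = 1 then v else 0).bind fun a => (unit a t).bind fun b => unit b w := by
          intro v w
          split_ifs
          · simp only [Multiset.bind_map, nsubst_rename_skip, Mono.nsubst_bind_unit]
          · simp
        simp only [e₂]
        by_cases ht : t = 0
        · simp only [ht, unit_zero, Multiset.singleton_bind]
          rw [split_unit_right u fun v => if v.card = 1 then v else 0, nsubst_var_self]
        · simp [unit_of_ne _ ht, split]
      · obtain ⟨m, rfl⟩ := exists_eq_skip hn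
        simp only [skip_skip hxy, nsubst_var_skip, hmap]
        rw [split_unit_left (var (skip x m)) u fun c w =>
          (Mono.nsubst t y w).bind fun T => c.nsubst x T]
        simp only [nsubst_var_skip]
        rw [Mono.nsubst_bind_unit]
        by_cases ht : t = 0 <;> simp [unit, ht, nsubst_var_skip]
  | hlam s ih =>
    intro x y hxy t u
    have h := ih (x + 1) (y + 1) (by omega) (t.map shift) (u.map shift)
    simp only [split_map_arg, ← nsubst_shift_mono, Multiset.bind_map] at h
    simp only [nsubst_lam, Multiset.bind_map, ← Multiset.map_bind, h, map_split]
    simp only [← map_shift_rename, liftRen_skip]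
  | happ s t ih iht =>
    intro x y hxy
    have key : SubstComm (fun t u => Mono.nsubst t y u) (Mono.nsubst t x)
        (fun a => Mono.nsubst a y)
        (fun v => Mono.nsubst t (y + 1) (v.map fun a => a.rename (skip x)))
        fun a => Mono.nsubst a x := by
      clear ih
      induction t using Multiset.induction with
      | empty =>
        intro t u
        simp only [Mono.nsubst_zero_eq_unit]
        have hmap : ∀ v : Mono, unit (0 : Mono) (v.map fun b => b.rename (skip x)) = unit 0 v := by
          intro v
          by_cases h : v = 0 <;> simp [unit, h]
        simp only [hmap]
        rw [split_unit_left _ u fun c w => (Mono.nsubst t y w).bind fun T => Mono.nsubst c x T]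
        simp only [Mono.nsubst_zero_eq_unit]
        rw [Mono.nsubst_bind_unit]
        by_cases ht : t = 0 <;> simp [unit, ht, Mono.nsubst_zero_eq_unit]
      | cons a t ih =>
        have h := substComm_conv (Mono.splitComm_nsubst y) (iht a (by simp) x y hxy)
          (ih fun b hb => iht b (by simp [hb])) (hα := (· ::ₘ ·)) (hβ := (· ::ₘ ·))
          (hγ := (· ::ₘ ·)) (F' := fun a => Mono.nsubst a y) (G' := fun a => Mono.nsubst a x)
          (fun a b => Mono.nsubst_cons_eq_conv a b y) (fun a b => Mono.nsubst_cons_eq_conv a b x)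
        simp only [Mono.nsubst_cons_eq_conv, conv_map_arg]
        exact h
    have h := substComm_conv (Mono.splitComm_nsubst y) (ih x y hxy) key (hα := app) (hβ := app)
      (hγ := app) (F' := fun a => a.nsubst y) (G' := fun a => a.nsubst x)
      (fun a b => nsubst_app_eq_conv a b y) (fun a b => nsubst_app_eq_conv a b x)
    simp only [nsubst_app_eq_conv, conv_map_arg]
    exact h
  | hinl s ih =>
    intro x y hxy t u
    have h := ih x y hxy t u
    simp only [nsubst_inl, Multiset.bind_map, ← Multiset.map_bind, h, map_split]
  | hinr s ih =>
    intro x y hxy t u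
    have h := ih x y hxy t u
    simp only [nsubst_inr, Multiset.bind_map, ← Multiset.map_bind, h, map_split]

end Term

end Resource

namespace Resource

/-! ### Reduction of sums -/

section SumReds

variable {X Y Z : Type}

/-- The reflexive and transitive closure of the reduction of sums. -/
abbrev SumReds (r : X → Sums X → Prop) : Sums X → Sums X → Prop :=
  Relation.ReflTransGen (SumRed r)

variable {r : X → Sums X → Prop}

theorem SumReds.of_red {e : X} {E : Sums X} (h : r e E) : SumReds r {e} E := by
  simpa using Relation.ReflTransGen.single (SumRed.mk 0 h)

theorem SumRed.add_right {E E' : Sums X} (h : SumRed r E E') (F : Sums X) :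
    SumRed r (E + F) (E' + F) := by
  obtain ⟨G, h⟩ := h
  rw [add_assoc, add_assoc]
  exact ⟨_, h⟩

theorem SumReds.add_right {E E' : Sums X} (h : SumReds r E E') (F : Sums X) :
    SumReds r (E + F) (E' + F) :=
  Relation.ReflTransGen.lift (· + F) (fun _ _ h => h.add_right F) _ _ h

theorem SumReds.add {E E' F F' : Sums X} (h : SumReds r E E') (h' : SumReds r F F') :
    SumReds r (E + F) (E' + F') := by
  refine (h.add_right F).trans ?_
  rw [add_comm E', add_comm E']
  exact h'.add_right E'

theorem SumReds.bind_congr {A : Type} {S : Multiset A} {f g : A → Sums X}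
    (h : ∀ a ∈ S, SumReds r (f a) (g a)) : SumReds r (S.bind f) (S.bind g) := by
  induction S using Multiset.induction with
  | empty => exact .refl
  | cons a S ih =>
    rw [Multiset.cons_bind, Multiset.cons_bind]
    exact (h a (by simp)).add (ih fun b hb => h b (by simp [hb]))

theorem SumReds.map_bind {A : Type} {S : Multiset A} {f : A → X} {g : A → Sums X}
    (h : ∀ a ∈ S, SumReds r {f a} (g a)) : SumReds r (S.map f) (S.bind g) := by
  rw [← Multiset.bind_singleton]
  exact .bind_congr h

theorem SumReds.map_map {A : Type} {S : Multiset A} {f g : A → X}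
    (h : ∀ a ∈ S, r (f a) {g a}) : SumReds r (S.map f) (S.map g) := by
  rw [← Multiset.bind_singleton _ g]
  exact .map_bind fun a ha => .of_red (h a ha)

theorem SumReds.bind {r' : Y → Sums Y → Prop} {E E' : Sums X} {f : X → Sums Y}
    (hf : ∀ e S, r e S → SumReds r' (f e) (S.bind f)) (h : SumReds r E E') :
    SumReds r' (E.bind f) (E'.bind f) := by
  induction h with
  | refl => exact .refl
  | tail _ h ih =>
    obtain ⟨F, h⟩ := h
    refine ih.trans ?_
    rw [Multiset.add_bind, Multiset.add_bind, Multiset.singleton_bind]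
    exact (hf _ _ h).add_right _

theorem SumReds.map {r' : Y → Sums Y → Prop} {E E' : Sums X} {f : X → Y}
    (hf : ∀ e S, r e S → r' (f e) (S.map f)) (h : SumReds r E E') :
    SumReds r' (E.map f) (E'.map f) := by
  rw [← Multiset.bind_singleton _ f, ← Multiset.bind_singleton _ f]
  refine h.bind fun e S he => ?_
  rw [Multiset.bind_singleton]
  exact .of_red (hf e S he)

/-- Normal sums. -/
def Normal (r : X → Sums X → Prop) (N : Sums X) : Prop := ∀ N', ¬ SumRed r N N'

theorem normal_iff {N : Sums X} : Normal r N ↔ ∀ x ∈ N, ∀ S, ¬ r x S := by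
  constructor
  · intro h x hx S hS
    obtain ⟨M, rfl⟩ := Multiset.exists_cons_of_mem hx
    rw [← Multiset.singleton_add] at h
    exact h _ ⟨M, hS⟩
  · rintro h _ ⟨F, hS⟩
    exact h _ (by simp) _ hS

theorem Normal.eq_of_sumReds {N E : Sums X} (hN : Normal r N) (h : SumReds r N E) : N = E := by
  rcases h.cases_head with h | ⟨_, h, -⟩
  · exact h
  · exact absurd h (hN _)

theorem SumRed.of_singleton {e : X} {E : Sums X} (h : SumRed r {e} E) : r e E := by
  generalize hF : ({e} : Sums X) = F at h
  obtain ⟨G, h⟩ := h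
  rw [Multiset.singleton_add, ← Multiset.cons_zero, Multiset.cons_eq_cons] at hF
  rcases hF with ⟨rfl, rfl⟩ | ⟨-, H, hH, -⟩
  · simpa using h
  · exact absurd hH.symm Multiset.cons_ne_zero

theorem SumRed.of_add {E F G : Sums X} (h : SumRed r (E + F) G) :
    (∃ E', SumRed r E E' ∧ G = E' + F) ∨ ∃ F', SumRed r F F' ∧ G = E + F' := by
  generalize hD : E + F = D at h
  obtain @⟨e, S, H, h⟩ := h
  rw [Multiset.singleton_add] at hD
  have he : e ∈ E + F := by simp [hD]
  rcases Multiset.mem_add.1 he with he | he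
  · obtain ⟨E, rfl⟩ := Multiset.exists_cons_of_mem he
    rw [Multiset.cons_add, Multiset.cons_inj_right] at hD
    subst hD
    exact .inl ⟨S + E, by rw [← Multiset.singleton_add]; exact ⟨E, h⟩, by rw [add_assoc]⟩
  · obtain ⟨F, rfl⟩ := Multiset.exists_cons_of_mem he
    rw [Multiset.add_cons, Multiset.cons_inj_right] at hD
    subst hD
    exact .inr ⟨S + F, by rw [← Multiset.singleton_add]; exact ⟨F, h⟩, by abel⟩

/-- Each step acts on one summand and leaves the others untouched. This is why convergence of a sum
can be checked on its elements. -/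
theorem SumReds.of_add {E F G : Sums X} (h : SumReds r (E + F) G) :
    ∃ E' F', SumReds r E E' ∧ SumReds r F F' ∧ G = E' + F' := by
  induction h with
  | refl => exact ⟨E, F, .refl, .refl, rfl⟩
  | tail _ h ih =>
    obtain ⟨E', F', hE, hF, rfl⟩ := ih
    rcases h.of_add with ⟨E'', hS, rfl⟩ | ⟨F'', hS, rfl⟩
    · exact ⟨E'', F', hE.tail hS, hF, rfl⟩
    · exact ⟨E', F'', hE, hF.tail hS, rfl⟩

theorem normal_zero : Normal r 0 := normal_iff.2 (by simp)

theorem Normal.bind {A : Type} {S : Multiset A} {f : A → Sums X} (h : ∀ a ∈ S, Normal r (f a)) :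
    Normal r (S.bind f) := by
  rw [normal_iff]
  intro x hx
  obtain ⟨a, ha, hx⟩ := Multiset.mem_bind.1 hx
  exact normal_iff.1 (h a ha) x hx

/-- Every reduct of `E` reduces to the normal sum `N`. -/
def Converges (r : X → Sums X → Prop) (E N : Sums X) : Prop :=
  Normal r N ∧ ∀ E', SumReds r E E' → SumReds r E' N

theorem Converges.bind {S : Sums X} {f : X → Sums X} (h : ∀ x ∈ S, Converges r {x} (f x)) :
    Converges r S (S.bind f) := by
  refine ⟨.bind fun x hx => (h x hx).1, ?_⟩
  induction S using Multiset.induction with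
  | empty =>
    intro E hE
    rw [← normal_zero.eq_of_sumReds hE]
    exact .refl
  | cons a S ih =>
    intro E hE
    rw [← Multiset.singleton_add] at hE
    obtain ⟨E₁, E₂, h₁, h₂, rfl⟩ := hE.of_add
    rw [Multiset.cons_bind]
    exact ((h a (by simp)).2 _ h₁).add (ih (fun x hx => h x (by simp [hx])) _ h₂)

/-- A common reduct. -/
def Joinable (r : X → Sums X → Prop) (E F : Sums X) : Prop :=
  ∃ G, SumReds r E G ∧ SumReds r F G

theorem Joinable.symm {E F : Sums X} (h : Joinable r E F) : Joinable r F E :=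
  let ⟨G, h₁, h₂⟩ := h; ⟨G, h₂, h₁⟩

theorem Joinable.map {r' : Y → Sums Y → Prop} {E E' : Sums X} {f : X → Y}
    (hf : ∀ e S, r e S → r' (f e) (S.map f)) (h : Joinable r E E') :
    Joinable r' (E.map f) (E'.map f) :=
  let ⟨G, h₁, h₂⟩ := h; ⟨G.map f, h₁.map hf, h₂.map hf⟩

theorem Converges.eq {E N N' : Sums X} (h : Converges r E N) (h' : IsNF r E N') : N' = N :=
  Normal.eq_of_sumReds (r := r) h'.2 (h.2 _ h'.1)

/-- Newman's lemma for reductions of sums that decrease a measure. -/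
theorem exists_converges (μ : X → ℕ) (hμ : ∀ e S, r e S → ∀ x ∈ S, μ x < μ e)
    (hr : ∀ e S T, r e S → r e T → Joinable r S T) (e : X) : ∃ N, Converges r {e} N := by
  induction hn : μ e using Nat.strong_induction_on generalizing e with
  | _ n ih =>
    subst hn
    by_cases he : ∃ S, r e S
    · obtain ⟨S, hS⟩ := he
      -- The implication makes the choice function `f` total; its value at elements that are not
      -- smaller than `e` is irrelevant.
      have hN : ∀ x, ∃ N, μ x < μ e → Converges r {x} N := fun x => by
        by_cases hx : μ x < μ e
        · obtain ⟨N, hN⟩ := ih _ hx x rfl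
          exact ⟨N, fun _ => hN⟩
        · exact ⟨0, fun h => absurd h hx⟩
      choose f hf using hN
      have hb : ∀ T, r e T → Converges r T (T.bind f) := fun T hT =>
        .bind fun x hx => hf x (hμ e T hT x hx)
      refine ⟨S.bind f, (hb S hS).1, fun E hE => ?_⟩
      rcases hE.cases_head with rfl | ⟨T, hT, hE⟩
      · exact (SumReds.of_red hS).trans ((hb S hS).2 _ .refl)
      · have hT := hT.of_singleton
        obtain ⟨G, h₁, h₂⟩ := hr e S T hS hT
        have h₃ := (hb T hT).2 _ (h₂.trans ((hb S hS).2 _ h₁))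
        rw [(hb S hS).1.eq_of_sumReds h₃]
        exact (hb T hT).2 _ hE
    · refine ⟨{e}, ?_⟩
      have h : Normal r {e} := normal_iff.2 fun x hx S hS => by
        rw [Multiset.mem_singleton] at hx
        exact he ⟨S, hx ▸ hS⟩
      exact ⟨h, fun E hE => h.eq_of_sumReds hE ▸ .refl⟩

theorem Converges.nf_eq {E N : Sums X} (h : Converges r E N) : nf r E = N := by
  have hN : ∃ N, IsNF r E N := ⟨N, h.2 _ .refl, h.1⟩
  rw [nf, dif_pos hN]
  exact h.eq hN.choose_spec

theorem converges_nf (hr : ∀ e, ∃ N, Converges r {e} N) (e : X) :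
    Converges r {e} (nf r {e}) := by
  obtain ⟨N, hN⟩ := hr e
  rwa [hN.nf_eq]

theorem existsUnique_isNF (hr : ∀ e, ∃ N, Converges r {e} N) (e : X) :
    ∃! N, IsNF r {e} N := by
  obtain ⟨N, hN⟩ := hr e
  exact ⟨N, ⟨hN.2 _ .refl, hN.1⟩, fun N' h' => hN.eq h'⟩

/-- A normal form may be computed along any chosen reduction, in particular along a parallel one. -/
theorem nf_eq_bind (hr : ∀ e, ∃ N, Converges r {e} N) {e : X} {S : Sums X}
    (h : SumReds r {e} S) : nf r {e} = S.bind fun x => nf r {x} := by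
  have hS : Converges r S (S.bind fun x => nf r {x}) := .bind fun x _ => converges_nf hr x
  refine Converges.nf_eq ⟨hS.1, fun E hE => ?_⟩
  have he := converges_nf hr e
  have h₁ : S.bind (fun x => nf r {x}) = nf r {e} :=
    hS.1.eq_of_sumReds (he.2 _ (h.trans (hS.2 _ .refl)))
  rw [h₁]
  exact he.2 _ hE

end SumReds

end Resource

namespace Resource

/-! ### Reduction inside a convolution -/

section Conv

variable {M α β γ A : Type}

theorem conv_bind_left (h : α → β → γ) (S : Multiset A) (f : A → Multiset M → Multiset α)
    (g : Multiset M → Multiset β) (u : Multiset M) :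
    conv h (fun v => S.bind fun a => f a v) g u = S.bind fun a => conv h (f a) g u := by
  simp only [conv_eq_split, bind_split, Multiset.bind_assoc]

theorem conv_bind_right (h : α → β → γ) (S : Multiset A) (f : Multiset M → Multiset α)
    (g : A → Multiset M → Multiset β) (u : Multiset M) :
    conv h f (fun v => S.bind fun a => g a v) u = S.bind fun a => conv h f (g a) u := by
  simp only [conv_eq_split, bind_split, Multiset.map_bind]
  exact split_congr fun v w _ => Multiset.bind_bind _ _

theorem conv_reds {rα : α → Sums α → Prop} {rβ : β → Sums β → Prop} {rγ : γ → Sums γ → Prop}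
    {h : α → β → γ} (hα : ∀ a b S, rα a S → rγ (h a b) (S.map fun a' => h a' b))
    (hβ : ∀ a b S, rβ b S → rγ (h a b) (S.map (h a)))
    {f f' : Multiset M → Multiset α} {g g' : Multiset M → Multiset β}
    (hf : ∀ v, SumReds rα (f v) (f' v)) (hg : ∀ v, SumReds rβ (g v) (g' v)) (u : Multiset M) :
    SumReds rγ (conv h f g u) (conv h f' g' u) := by
  refine .bind_congr fun p _ => ?_
  refine (SumReds.bind_congr (g := fun a => (g' p.2).map (h a)) fun a _ =>
    (hg p.2).map fun b S hb => hβ a b S hb).trans ((hf p.1).bind fun a S ha => ?_)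
  rw [Multiset.bind_map_comm]
  exact .map_bind fun b _ => .of_red (hα a b S ha)

/-- By the Leibniz rule `conv_cons`, the element `m` is consumed on one side only, and it is reduced
on that side. -/
theorem conv_cons_reds {rα : α → Sums α → Prop} {rβ : β → Sums β → Prop}
    {rγ : γ → Sums γ → Prop}
    {h : α → β → γ} (hα : ∀ a b S, rα a S → rγ (h a b) (S.map fun a' => h a' b))
    (hβ : ∀ a b S, rβ b S → rγ (h a b) (S.map (h a)))
    {f : Multiset M → Multiset α} {g : Multiset M → Multiset β} {m : M} {S : Multiset M}
    (hf : ∀ v, SumReds rα (f (m ::ₘ v)) (S.bind fun m' => f (m' ::ₘ v)))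
    (hg : ∀ v, SumReds rβ (g (m ::ₘ v)) (S.bind fun m' => g (m' ::ₘ v))) (u : Multiset M) :
    SumReds rγ (conv h f g (m ::ₘ u)) (S.bind fun m' => conv h f g (m' ::ₘ u)) := by
  simp only [conv_cons, Multiset.bind_add]
  rw [← conv_bind_right h S f fun m' v => g (m' ::ₘ v),
    ← conv_bind_left h S (fun m' v => f (m' ::ₘ v)) g]
  exact (conv_reds hα hβ (fun _ => .refl) hg u).add (conv_reds hα hβ hf (fun _ => .refl) u)

end Conv

namespace Term

/-! ### A measure that decreases under reduction -/

/-- A weight of terms that decreases under reduction. -/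
noncomputable def weight : Term → ℕ :=
  QPF.Fix.rec fun l : Layer ℕ =>
    match l with
    | .var _ => 1
    | .lam s => 2 * s
    | .app s t => 2 * s * t.prod
    | .inl s => s + 1
    | .inr s => s + 1

end Term

/-- The product of the weights of the elements of a monomial. -/
noncomputable def Mono.weight (t : Mono) : ℕ := (t.map Term.weight).prod

namespace Term

theorem weight_var (n : ℕ) : (var n).weight = 1 := by
  simp only [weight, var, QPF.Fix.rec_eq]; rfl
theorem weight_lam (s : Term) : (lam s).weight = 2 * s.weight := by
  simp only [weight, lam, QPF.Fix.rec_eq]; rfl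
theorem weight_app (s : Term) (t : Mono) : (app s t).weight = 2 * s.weight * t.weight := by
  simp only [weight, app, QPF.Fix.rec_eq]; rfl
theorem weight_inl (s : Term) : (inl s).weight = s.weight + 1 := by
  simp only [weight, inl, QPF.Fix.rec_eq]; rfl
theorem weight_inr (s : Term) : (inr s).weight = s.weight + 1 := by
  simp only [weight, inr, QPF.Fix.rec_eq]; rfl

theorem _root_.Resource.Mono.weight_zero : Mono.weight 0 = 1 := by simp [Mono.weight]
theorem _root_.Resource.Mono.weight_cons (a : Term) (t : Mono) :
    Mono.weight (a ::ₘ t) = a.weight * t.weight := by simp [Mono.weight]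
theorem _root_.Resource.Mono.weight_add (t t' : Mono) :
    Mono.weight (t + t') = t.weight * t'.weight := by simp [Mono.weight]

theorem weight_pos (s : Term) : 0 < s.weight := by
  induction s using ind with
  | hvar n => simp [weight_var]
  | hlam s ih => simpa [weight_lam]
  | happ s t ih iht =>
    rw [weight_app]
    refine Nat.mul_pos (by omega) (Nat.pos_of_ne_zero fun h => ?_)
    obtain ⟨a, ha, h0⟩ := Multiset.mem_map.1 (Multiset.prod_eq_zero_iff.1 h)
    exact (iht a ha).ne' h0
  | hinl s ih => simp [weight_inl]
  | hinr s ih => simp [weight_inr]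

theorem _root_.Resource.Mono.weight_pos (t : Mono) : 0 < Mono.weight t := by
  refine Nat.pos_of_ne_zero fun h => ?_
  obtain ⟨a, -, h0⟩ := Multiset.mem_map.1 (Multiset.prod_eq_zero_iff.1 h)
  exact a.weight_pos.ne' h0

theorem weight_rename (s : Term) : ∀ f, (s.rename f).weight = s.weight := by
  induction s using ind with
  | hvar n => simp [rename_var, weight_var]
  | hlam s ih => simp [rename_lam, weight_lam, ih]
  | happ s t ih iht =>
    intro f
    simp only [rename_app, weight_app, ih, Mono.weight, Multiset.map_map, Function.comp_apply]
    rw [Multiset.map_congr rfl fun a ha => iht a ha f]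
  | hinl s ih => simp [rename_inl, weight_inl, ih]
  | hinr s ih => simp [rename_inr, weight_inr, ih]

theorem weight_map_shift (u : Mono) : Mono.weight (u.map shift) = u.weight := by
  simp [Mono.weight, shift, weight_rename, Function.comp_def]

theorem weight_nsubst_mono {t : Mono} {x : ℕ}
    (h : ∀ a ∈ t, ∀ u, ∀ e ∈ a.nsubst x u, e.weight ≤ a.weight * Mono.weight u) {u T : Mono}
    (hT : T ∈ Mono.nsubst t x u) : T.weight ≤ t.weight * u.weight := by
  induction t using Multiset.induction generalizing u T with
  | empty =>
    rw [Mono.nsubst_zero_eq_unit, mem_unit] at hT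
    simp [hT, Mono.weight_zero]
  | cons a t ih =>
    rw [Mono.nsubst_cons_eq_conv, mem_conv] at hT
    obtain ⟨v, w, b, T, rfl, hb, hT, rfl⟩ := hT
    have h₁ := h a (by simp) _ _ hb
    have h₂ := ih (fun b hb => h b (by simp [hb])) hT
    rw [Mono.weight_cons, Mono.weight_cons, Mono.weight_add]
    exact (Nat.mul_le_mul h₁ h₂).trans_eq (by ring)

/-- Weights multiply because every element of `u` is used exactly once. The unit added by a choice
is harmless, as the weight of `u` is at least `1`. -/
theorem weight_nsubst (s : Term) : ∀ x u, ∀ e ∈ s.nsubst x u,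
    e.weight ≤ s.weight * Mono.weight u := by
  induction s using ind with
  | hvar y =>
    intro x u e he
    by_cases hy : y = x
    · subst hy
      rw [nsubst_var_self] at he
      split_ifs at he with h
      · obtain ⟨a, rfl⟩ := Multiset.card_eq_one.1 h
        rw [Multiset.mem_singleton] at he
        simp [he, weight_var, Mono.weight]
      · simp at he
    · obtain ⟨n, rfl⟩ := exists_eq_skip hy
      rw [nsubst_var_skip, mem_unit] at he
      simp [he, weight_var, Mono.weight]
  | hlam s ih =>
    intro x u e he
    rw [nsubst_lam] at he
    obtain ⟨e', he', rfl⟩ := Multiset.mem_map.1 he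
    have h := ih _ _ e' he'
    rw [weight_map_shift] at h
    rw [weight_lam, weight_lam, mul_assoc]
    omega
  | happ s t ih iht =>
    intro x u e he
    rw [nsubst_app_eq_conv, mem_conv] at he
    obtain ⟨v, w, a, T, rfl, ha, hT, rfl⟩ := he
    have h₁ := ih _ _ _ ha
    have h₂ := weight_nsubst_mono (fun b hb => iht b hb x) hT
    rw [weight_app, weight_app, Mono.weight_add]
    exact (Nat.mul_le_mul (Nat.mul_le_mul_left 2 h₁) h₂).trans_eq (by ring)
  | hinl s ih =>
    intro x u e he
    rw [nsubst_inl] at he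
    obtain ⟨e', he', rfl⟩ := Multiset.mem_map.1 he
    have h := ih _ _ e' he'
    have hu := Mono.weight_pos u
    rw [weight_inl, weight_inl, add_mul, one_mul]
    omega
  | hinr s ih =>
    intro x u e he
    rw [nsubst_inr] at he
    obtain ⟨e', he', rfl⟩ := Multiset.mem_map.1 he
    have h := ih _ _ e' he'
    have hu := Mono.weight_pos u
    rw [weight_inr, weight_inr, add_mul, one_mul]
    omega

theorem weight_beta {s : Term} {t : Mono} {e : Term} (he : e ∈ s.nsubst 0 t) :
    e.weight < (app (lam s) t).weight := by
  have h := weight_nsubst s 0 t e he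
  have h₁ := Nat.mul_pos s.weight_pos t.weight_pos
  rw [weight_app, weight_lam, ← mul_assoc, mul_assoc]
  omega

/-- The factors `2` make a choice cost more inside an abstraction or in function position than
outside. They also leave a factor `4` in the weight of a β-redex over the bound given by
`weight_nsubst`. Steps in a context decrease strictly because weights are positive. -/
theorem Red.weight_lt {s : Term} {S : Sums Term} (h : Red s S) :
    ∀ e ∈ S, e.weight < s.weight := by
  induction h with
  | beta s t => exact fun e he => weight_beta he
  | app_inl s t | app_inr s t =>
    intro e he
    have h₁ := Mono.weight_pos t
    rw [Multiset.mem_singleton.1 he]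
    simp only [weight_inl, weight_inr, weight_app, mul_add, add_mul]
    omega
  | lam_inl s | lam_inr s =>
    intro e he
    rw [Multiset.mem_singleton.1 he]
    simp only [weight_inl, weight_inr, weight_lam]
    omega
  | lam h ih =>
    intro e he
    obtain ⟨e', he', rfl⟩ := Multiset.mem_map.1 he
    have := ih e' he'
    simp only [weight_lam]
    omega
  | app_left t h ih =>
    intro e he
    obtain ⟨e', he', rfl⟩ := Multiset.mem_map.1 he
    have := ih e' he'
    have h₁ := Mono.weight_pos t
    simp only [weight_app]
    gcongr
  | app_right r t h ih =>
    intro e he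
    obtain ⟨e', he', rfl⟩ := Multiset.mem_map.1 he
    have := ih e' he'
    have h₁ := Mono.weight_pos t
    have h₂ := r.weight_pos
    simp only [weight_app, Mono.weight_cons]
    gcongr
  | inl h ih | inr h ih =>
    intro e he
    obtain ⟨e', he', rfl⟩ := Multiset.mem_map.1 he
    have := ih e' he'
    simp only [weight_inl, weight_inr]
    omega

/-! ### Inversion of reduction steps -/

theorem not_red_var {n : ℕ} {S : Sums Term} : ¬ Red (var n) S := by
  intro h
  generalize he : var n = e at h
  cases h <;> simp at he

theorem red_lam_iff {s : Term} {S : Sums Term} :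
    Red (lam s) S ↔ (∃ s₀, s = inl s₀ ∧ S = {inl (lam s₀)}) ∨
      (∃ s₀, s = inr s₀ ∧ S = {inr (lam s₀)}) ∨ ∃ S₀, Red s S₀ ∧ S = S₀.map lam := by
  constructor
  · intro h
    generalize he : lam s = e at h
    cases h <;> simp at he
    case lam_inl s₀ => exact .inl ⟨s₀, he, rfl⟩
    case lam_inr s₀ => exact .inr (.inl ⟨s₀, he, rfl⟩)
    case lam s' S₀ h => exact .inr (.inr ⟨S₀, he ▸ h, rfl⟩)
  · rintro (⟨s, rfl, rfl⟩ | ⟨s, rfl, rfl⟩ | ⟨S, h, rfl⟩)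
    exacts [.lam_inl s, .lam_inr s, .lam h]

theorem red_app_iff {s : Term} {t : Mono} {S : Sums Term} :
    Red (app s t) S ↔ (∃ s₀, s = lam s₀ ∧ S = s₀.nsubst 0 t) ∨
      (∃ s₀, s = inl s₀ ∧ S = {inl (app s₀ t)}) ∨
      (∃ s₀, s = inr s₀ ∧ S = {inr (app s₀ t)}) ∨
      (∃ S₀, Red s S₀ ∧ S = S₀.map fun s' => app s' t) ∨
      ∃ a t' A, t = a ::ₘ t' ∧ Red a A ∧ S = A.map fun a' => app s (a' ::ₘ t') := by
  constructor
  · intro h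
    generalize he : app s t = e at h
    cases h <;> simp at he
    case beta s₀ t => exact .inl ⟨s₀, he.1, by rw [he.2]⟩
    case app_inl s₀ t => exact .inr (.inl ⟨s₀, he.1, by rw [he.2]⟩)
    case app_inr s₀ t => exact .inr (.inr (.inl ⟨s₀, he.1, by rw [he.2]⟩))
    case app_left s' S₀ t h => exact .inr (.inr (.inr (.inl ⟨S₀, he.1 ▸ h, by rw [he.2]⟩)))
    case app_right a A r t h =>
      exact .inr (.inr (.inr (.inr ⟨a, t, A, he.2, h, by rw [he.1]⟩)))
  · rintro (⟨s, rfl, rfl⟩ | ⟨s, rfl, rfl⟩ | ⟨s, rfl, rfl⟩ | ⟨S, h, rfl⟩ | ⟨a, t, A, rfl, h, rfl⟩)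
    exacts [.beta s t, .app_inl s t, .app_inr s t, .app_left t h, .app_right s t h]

theorem red_inl_iff {s : Term} {S : Sums Term} :
    Red (inl s) S ↔ ∃ S₀, Red s S₀ ∧ S = S₀.map inl := by
  constructor
  · intro h
    generalize he : inl s = e at h
    cases h <;> simp at he
    case inl s' S₀ h => exact ⟨S₀, he ▸ h, rfl⟩
  · rintro ⟨S, h, rfl⟩
    exact .inl h

theorem red_inr_iff {s : Term} {S : Sums Term} :
    Red (inr s) S ↔ ∃ S₀, Red s S₀ ∧ S = S₀.map inr := by
  constructor
  · intro h
    generalize he : inr s = e at h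
    cases h <;> simp at he
    case inr s' S₀ h => exact ⟨S₀, he ▸ h, rfl⟩
  · rintro ⟨S, h, rfl⟩
    exact .inr h

/-! ### Reduction and substitution -/

theorem Red.app_mono {r : Term} {t : Mono} {T : Sums Mono} (h : Mono.Red t T) :
    Red (app r t) (T.map (app r)) := by
  obtain ⟨t, h⟩ := h
  rw [Multiset.map_map]
  exact .app_right r t h

theorem _root_.Resource.Mono.Red.cons {t : Mono} {T : Sums Mono} (a : Term) (h : Mono.Red t T) :
    Mono.Red (a ::ₘ t) (T.map (a ::ₘ ·)) := by
  obtain @⟨s, S, t, h⟩ := h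
  simp only [Multiset.map_map, Function.comp_def, Multiset.cons_swap a]
  exact .mk (a ::ₘ t) h

theorem Red.rename {s : Term} {S : Sums Term} (h : Red s S) : ∀ f : ℕ → ℕ,
    Red (s.rename f) (S.map fun a => a.rename f) := by
  induction h with
  | beta s t =>
    intro f
    rw [rename_app, rename_lam, nsubst_rename s 0 0 f (liftRen f) t rfl]
    · exact .beta _ _
    · intro n
      rw [skip_zero]
      rfl
  | app_inl s t =>
    intro f
    simp only [rename_app, rename_inl, Multiset.map_singleton]
    exact .app_inl _ _
  | app_inr s t =>
    intro f
    simp only [rename_app, rename_inr, Multiset.map_singleton]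
    exact .app_inr _ _
  | lam_inl s =>
    intro f
    simp only [rename_lam, rename_inl, Multiset.map_singleton]
    exact .lam_inl _
  | lam_inr s =>
    intro f
    simp only [rename_lam, rename_inr, Multiset.map_singleton]
    exact .lam_inr _
  | lam h ih =>
    intro f
    have := Red.lam (ih (liftRen f))
    simpa only [rename_lam, Multiset.map_map, Function.comp_def] using this
  | app_left t h ih =>
    intro f
    have := Red.app_left (t.map fun a => a.rename f) (ih f)
    simpa only [rename_app, Multiset.map_map, Function.comp_def] using this
  | app_right r t h ih =>
    intro f
    have := Red.app_right (r.rename f) (t.map fun a => a.rename f) (ih f)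
    simpa only [rename_app, Multiset.map_map, Function.comp_def, Multiset.map_cons] using this
  | inl h ih =>
    intro f
    have := Red.inl (ih f)
    simpa only [rename_inl, Multiset.map_map, Function.comp_def] using this
  | inr h ih =>
    intro f
    have := Red.inr (ih f)
    simpa only [rename_inr, Multiset.map_map, Function.comp_def] using this

theorem nsubst_cons_reds_mono {t : Mono} {x : ℕ} {a : Term} {A : Sums Term}
    (ih : ∀ s ∈ t, ∀ u, SumReds Red (s.nsubst x (a ::ₘ u)) (A.bind fun b => s.nsubst x (b ::ₘ u)))
    (u : Mono) :
    SumReds Mono.Red (Mono.nsubst t x (a ::ₘ u)) (A.bind fun b => Mono.nsubst t x (b ::ₘ u)) := by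
  induction t using Multiset.induction generalizing u with
  | empty =>
    simp only [Mono.nsubst_zero_eq_unit]
    simp [unit_of_ne, Relation.ReflTransGen.refl]
  | cons c t iht =>
    simp only [Mono.nsubst_cons_eq_conv]
    exact conv_cons_reds (fun a b S h => .mk b h) (fun a b S h => Mono.Red.cons a h) (ih c (by simp))
      (iht fun s hs => ih s (by simp [hs])) u

/-- Substitution is compatible with a reduction of one of the substituted terms. -/
theorem nsubst_cons_reds (s : Term) : ∀ (x : ℕ) (a : Term) (A : Sums Term), Red a A → ∀ u,
    SumReds Red (s.nsubst x (a ::ₘ u)) (A.bind fun b => s.nsubst x (b ::ₘ u)) := by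
  induction s using ind with
  | hvar y =>
    intro x a A h u
    by_cases hy : y = x
    · subst hy
      rcases eq_or_ne u 0 with rfl | hu
      · simpa [nsubst_var_self, bind_singleton_self] using SumReds.of_red h
      · simp [nsubst_var_self, hu, Relation.ReflTransGen.refl]
    · obtain ⟨n, rfl⟩ := exists_eq_skip hy
      simp [nsubst_var_skip, unit_of_ne, Relation.ReflTransGen.refl]
  | hlam s ih =>
    intro x a A h u
    have h' : Red (shift a) (A.map shift) := h.rename Nat.succ
    have := (ih (x + 1) (shift a) _ h' (u.map shift)).map (f := lam)
      fun e S he => Red.lam he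
    simpa only [nsubst_lam, Multiset.map_cons, Multiset.bind_map, Multiset.map_bind] using this
  | happ s t ih iht =>
    intro x a A h u
    simp only [nsubst_app_eq_conv]
    exact conv_cons_reds (fun a b S h => .app_left b h) (fun a b S h => .app_mono h)
      (ih x a A h) (nsubst_cons_reds_mono fun b hb => iht b hb x a A h) u
  | hinl s ih =>
    intro x a A h u
    have := (ih x a A h u).map (f := inl) fun e S he => Red.inl he
    simpa only [nsubst_inl, Multiset.map_bind] using this
  | hinr s ih =>
    intro x a A h u
    have := (ih x a A h u).map (f := inr) fun e S he => Red.inr he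
    simpa only [nsubst_inr, Multiset.map_bind] using this

/-- Substitution is compatible with a reduction of the term substituted into. -/
theorem Red.nsubst {s : Term} {S : Sums Term} (h : Red s S) : ∀ (x : ℕ) (u : Mono),
    SumReds Red (s.nsubst x u) (S.bind fun s' => s'.nsubst x u) := by
  induction h with
  | beta s t =>
    intro x u
    -- The contracted variable has index `0`; the substitution for `x` happens at index `x + 1`
    -- under the binder.
    have h := substComm_nsubst s 0 x x.zero_le t u
    simp only at h
    rw [h, nsubst_app, skip_zero]
    refine .bind_congr fun p _ => ?_
    simp only [nsubst_lam, Multiset.bind_map]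
    refine .bind_congr fun a _ => .map_bind fun b _ => .of_red (.beta a b)
  | app_inl s t =>
    intro x u
    simp only [nsubst_app_eq_conv, nsubst_inl, Multiset.singleton_bind, map_conv]
    refine .bind_congr fun p _ => ?_
    simp only [nsubst_inl, Multiset.bind_map]
    exact .bind_congr fun a _ => .map_map fun b _ => .app_inl a b
  | app_inr s t =>
    intro x u
    simp only [nsubst_app_eq_conv, nsubst_inr, Multiset.singleton_bind, map_conv]
    refine .bind_congr fun p _ => ?_
    simp only [nsubst_inr, Multiset.bind_map]
    exact .bind_congr fun a _ => .map_map fun b _ => .app_inr a b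
  | lam_inl s =>
    intro x u
    simp only [nsubst_lam, nsubst_inl, Multiset.singleton_bind, Multiset.map_map]
    exact .map_map fun a _ => .lam_inl a
  | lam_inr s =>
    intro x u
    simp only [nsubst_lam, nsubst_inr, Multiset.singleton_bind, Multiset.map_map]
    exact .map_map fun a _ => .lam_inr a
  | lam h ih =>
    intro x u
    have := (ih (x + 1) (u.map shift)).map (f := Term.lam) fun e S he => Red.lam he
    simpa only [nsubst_lam, Multiset.bind_map, Multiset.map_bind] using this
  | app_left t h ih =>
    intro x u
    simp only [nsubst_app_eq_conv, Multiset.bind_map, ← conv_bind_left]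
    exact conv_reds (fun a b S h => .app_left b h) (fun a b S h => .app_mono h)
      (ih x) (fun _ => .refl) u
  | app_right r t h ih =>
    intro x u
    simp only [nsubst_app_eq_conv, Multiset.bind_map, ← conv_bind_right,
      Mono.nsubst_cons_eq_conv, ← conv_bind_left]
    exact conv_reds (fun a b S h => .app_left b h) (fun a b S h => .app_mono h)
      (fun _ => .refl) (conv_reds (fun a b S h => .mk b h) (fun a b S h => Mono.Red.cons a h) (ih x)
        fun _ => .refl) u
  | inl h ih =>
    intro x u
    have := (ih x u).map (f := Term.inl) fun e S he => Red.inl he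
    simpa only [nsubst_inl, Multiset.bind_map, Multiset.map_bind] using this
  | inr h ih =>
    intro x u
    have := (ih x u).map (f := Term.inr) fun e S he => Red.inr he
    simpa only [nsubst_inr, Multiset.bind_map, Multiset.map_bind] using this

/-! ### Local confluence -/

/-- If the abstraction exposes a choice, moving the choice out of the application as well and then
contracting gives the same result as β. Otherwise the body reduces, and substitution follows it. -/
theorem joinable_beta_left {s : Term} {S : Sums Term} (h : Red (lam s) S) (t : Mono) :
    Joinable Red (s.nsubst 0 t) (S.map fun s' => app s' t) := by
  rcases red_lam_iff.1 h with ⟨p, rfl, rfl⟩ | ⟨p, rfl, rfl⟩ | ⟨S, h', rfl⟩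
  · refine ⟨_, .refl, ?_⟩
    rw [nsubst_inl, Multiset.map_singleton]
    exact (SumReds.of_red (.app_inl _ _)).trans (SumReds.of_red (.inl (.beta p t)))
  · refine ⟨_, .refl, ?_⟩
    rw [nsubst_inr, Multiset.map_singleton]
    exact (SumReds.of_red (.app_inr _ _)).trans (SumReds.of_red (.inr (.beta p t)))
  · refine ⟨_, h'.nsubst 0 t, ?_⟩
    rw [Multiset.map_map]
    exact .map_bind fun a _ => .of_red (.beta a t)

theorem joinable_beta_right {a : Term} {A : Sums Term} (h : Red a A) (s : Term) (t : Mono) :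
    Joinable Red (s.nsubst 0 (a ::ₘ t)) (A.map fun a' => app (lam s) (a' ::ₘ t)) :=
  ⟨_, nsubst_cons_reds s 0 a A h t, .map_bind fun _ _ => .of_red (.beta _ _)⟩

theorem joinable_inl_left {s : Term} {S : Sums Term} (h : Red (inl s) S) (t : Mono) :
    Joinable Red {inl (app s t)} (S.map fun s' => app s' t) := by
  obtain ⟨S, h', rfl⟩ := red_inl_iff.1 h
  refine ⟨_, .of_red (.inl (.app_left t h')), ?_⟩
  rw [Multiset.map_map, Multiset.map_map]
  exact .map_map fun a _ => .app_inl a t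

theorem joinable_inr_left {s : Term} {S : Sums Term} (h : Red (inr s) S) (t : Mono) :
    Joinable Red {inr (app s t)} (S.map fun s' => app s' t) := by
  obtain ⟨S, h', rfl⟩ := red_inr_iff.1 h
  refine ⟨_, .of_red (.inr (.app_left t h')), ?_⟩
  rw [Multiset.map_map, Multiset.map_map]
  exact .map_map fun a _ => .app_inr a t

theorem joinable_inl_right {a : Term} {A : Sums Term} (h : Red a A) (s : Term) (t : Mono) :
    Joinable Red {inl (app s (a ::ₘ t))} (A.map fun a' => app (inl s) (a' ::ₘ t)) := by
  refine ⟨_, .of_red (.inl (.app_right s t h)), ?_⟩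
  rw [Multiset.map_map]
  exact .map_map fun _ _ => .app_inl _ _

theorem joinable_inr_right {a : Term} {A : Sums Term} (h : Red a A) (s : Term) (t : Mono) :
    Joinable Red {inr (app s (a ::ₘ t))} (A.map fun a' => app (inr s) (a' ::ₘ t)) := by
  refine ⟨_, .of_red (.inr (.app_right s t h)), ?_⟩
  rw [Multiset.map_map]
  exact .map_map fun _ _ => .app_inr _ _

theorem joinable_left_right {s a : Term} {S A : Sums Term} (hs : Red s S) (ha : Red a A)
    (t : Mono) : Joinable Red (S.map fun s' => app s' (a ::ₘ t))
      (A.map fun a' => app s (a' ::ₘ t)) := by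
  refine ⟨S.bind fun s' => A.map fun a' => app s' (a' ::ₘ t),
    .map_bind fun s' _ => .of_red (.app_right s' t ha), ?_⟩
  rw [Multiset.bind_map_comm]
  exact .map_bind fun a' _ => .of_red (.app_left _ hs)

theorem joinable_lam_inl {s : Term} {S : Sums Term} (h : Red (inl s) S) :
    Joinable Red {inl (lam s)} (S.map lam) := by
  obtain ⟨S, h', rfl⟩ := red_inl_iff.1 h
  refine ⟨_, .of_red (.inl (.lam h')), ?_⟩
  rw [Multiset.map_map, Multiset.map_map]
  exact .map_map fun a _ => .lam_inl a

theorem joinable_lam_inr {s : Term} {S : Sums Term} (h : Red (inr s) S) :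
    Joinable Red {inr (lam s)} (S.map lam) := by
  obtain ⟨S, h', rfl⟩ := red_inr_iff.1 h
  refine ⟨_, .of_red (.inr (.lam h')), ?_⟩
  rw [Multiset.map_map, Multiset.map_map]
  exact .map_map fun a _ => .lam_inr a

theorem _root_.Resource.Joinable.refl (S : Sums Term) : Joinable Red S S := ⟨S, .refl, .refl⟩

theorem red_locallyConfluent (s : Term) : ∀ S T, Red s S → Red s T → Joinable Red S T := by
  induction s using ind with
  | hvar n => exact fun S T h => absurd h not_red_var
  | hlam s ih =>
    intro S T hS' hT'
    rcases red_lam_iff.1 hS' with ⟨p, rfl, rfl⟩ | ⟨p, rfl, rfl⟩ | ⟨S, hS, rfl⟩ <;>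
    rcases red_lam_iff.1 hT' with ⟨q, hq, rfl⟩ | ⟨q, hq, rfl⟩ | ⟨T, hT, rfl⟩
    · rw [inl_inj] at hq; rw [hq]; exact .refl _
    · simp at hq
    · exact joinable_lam_inl hT
    · simp at hq
    · rw [inr_inj] at hq; rw [hq]; exact .refl _
    · exact joinable_lam_inr hT
    · subst hq; exact (joinable_lam_inl hS).symm
    · subst hq; exact (joinable_lam_inr hS).symm
    · exact (ih _ _ hS hT).map fun _ _ h => Red.lam h
  | happ s t ih iht =>
    intro S T hS' hT'
    rcases red_app_iff.1 hS' with ⟨p, rfl, rfl⟩ | ⟨p, rfl, rfl⟩ | ⟨p, rfl, rfl⟩ | ⟨S, hS, rfl⟩ |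
      ⟨a, t, A, rfl, ha, rfl⟩ <;>
    rcases red_app_iff.1 hT' with ⟨q, hq, rfl⟩ | ⟨q, hq, rfl⟩ | ⟨q, hq, rfl⟩ | ⟨T, hT, rfl⟩ |
      ⟨b, t', B, hq, hb, rfl⟩
    · rw [lam_inj] at hq; rw [hq]; exact .refl _
    · simp at hq
    · simp at hq
    · exact joinable_beta_left hT t
    · subst hq; exact joinable_beta_right hb p t'
    · simp at hq
    · rw [inl_inj] at hq; rw [hq]; exact .refl _
    · simp at hq
    · exact joinable_inl_left hT t
    · subst hq; exact joinable_inl_right hb p t'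
    · simp at hq
    · simp at hq
    · rw [inr_inj] at hq; rw [hq]; exact .refl _
    · exact joinable_inr_left hT t
    · subst hq; exact joinable_inr_right hb p t'
    · subst hq; exact (joinable_beta_left hS t).symm
    · subst hq; exact (joinable_inl_left hS t).symm
    · subst hq; exact (joinable_inr_left hS t).symm
    · exact (ih _ _ hS hT).map fun _ _ h => .app_left t h
    · subst hq; exact joinable_left_right hS hb t'
    · subst hq; exact (joinable_beta_right ha q t).symm
    · subst hq; exact (joinable_inl_right ha q t).symm
    · subst hq; exact (joinable_inr_right ha q t).symm
    · exact (joinable_left_right hT ha t).symm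
    · rcases Multiset.cons_eq_cons.1 hq with ⟨rfl, rfl⟩ | ⟨-, c, rfl, rfl⟩
      · exact (iht a (by simp) _ _ ha hb).map fun _ _ h => .app_right s t h
      · refine ⟨A.bind fun a' => B.map fun b' => app s (a' ::ₘ b' ::ₘ c),
          .map_bind fun a' _ => ?_, ?_⟩
        · simp only [Multiset.cons_swap a']
          exact .of_red (.app_right s _ hb)
        · rw [Multiset.bind_map_comm]
          refine .map_bind fun b' _ => ?_
          rw [Multiset.cons_swap]
          exact .of_red (.app_right s _ ha)
  | hinl s ih =>
    intro S T hS' hT'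
    obtain ⟨S, hS, rfl⟩ := red_inl_iff.1 hS'
    obtain ⟨T, hT, rfl⟩ := red_inl_iff.1 hT'
    exact (ih _ _ hS hT).map fun _ _ h => Red.inl h
  | hinr s ih =>
    intro S T hS' hT'
    obtain ⟨S, hS, rfl⟩ := red_inr_iff.1 hS'
    obtain ⟨T, hT, rfl⟩ := red_inr_iff.1 hT'
    exact (ih _ _ hS hT).map fun _ _ h => Red.inr h

theorem exists_converges_red (s : Term) : ∃ N, Converges Red {s} N :=
  exists_converges weight (fun _ _ h => h.weight_lt) red_locallyConfluent s

end Term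

end Resource

namespace Resource

/-! ### Coefficients -/

section Coeff

variable {M X Y Z : Type}

theorem coeff_add (E F : Sums X) (x : X) : coeff (E + F) x = coeff E x + coeff F x := by
  simp [coeff]

theorem coeff_zero (x : X) : coeff 0 x = 0 := by simp [coeff]

theorem coeff_singleton_self (x : X) : coeff {x} x = 1 := by simp [coeff]

theorem coeff_cons_self (x : X) (E : Sums X) : coeff (x ::ₘ E) x = coeff E x + 1 := by
  simp [coeff]

open Classical in
theorem coeff_cons (x y : X) (E : Sums X) :
    coeff (y ::ₘ E) x = coeff E x + if x = y then 1 else 0 := by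
  simp [coeff, Multiset.count_cons]

theorem coeff_eq_zero {E : Sums X} {x : X} : coeff E x = 0 ↔ x ∉ E := by
  simp [coeff]

theorem mem_supp {E : Sums X} {x : X} : x ∈ supp E ↔ x ∈ E := by
  simp [supp, coeff]

theorem coeff_map_of_injective {φ : X → Y} (hφ : Function.Injective φ) (E : Sums X) (x : X) :
    coeff (E.map φ) (φ x) = coeff E x := by
  classical
  have := Multiset.count_map_eq_count' φ E hφ x
  simpa only [coeff] using (by convert this)

/-- When a single term of `S` can produce `y`, coefficients multiply instead of being added over
several sources. -/
theorem coeff_bind_of_unique {S : Sums X} {f : X → Sums Y} {x : X} {y : Y}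
    (h : ∀ x' ∈ S, y ∈ f x' → x' = x) : coeff (S.bind f) y = coeff S x * coeff (f x) y := by
  classical
  simp only [coeff, Multiset.count_bind]
  refine (Multiset.sum_map_eq_nsmul_single x fun x' hne hx' => ?_).trans (smul_eq_mul _ _)
  rw [Multiset.count_eq_zero]
  exact fun hy => hne (h x' hx' hy)

theorem coeff_map_eq_sum {φ : X → Y} (E : Sums X) {y : Y} {F : Finset X}
    (hF : ∀ x, φ x = y ↔ x ∈ F) : coeff (E.map φ) y = ∑ x ∈ F, coeff E x := by
  classical
  induction E using Multiset.induction with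
  | empty => simp [coeff_zero]
  | cons x E ih =>
    simp only [Multiset.map_cons, coeff_cons, ih, Finset.sum_add_distrib, Finset.sum_ite_eq',
      ← hF, eq_comm (a := y)]

open Classical in
theorem coeff_eq_sum (E : Sums X) (x : X) :
    coeff E x = (E.map fun y => if y = x then 1 else 0).sum := by
  induction E using Multiset.induction with
  | empty => simp [coeff_zero]
  | cons y E ih =>
    rw [coeff_cons, ih, Multiset.map_cons, Multiset.sum_cons, add_comm]
    simp only [eq_comm]

theorem coeff_conv {h : X → Y → Z} (hinj : ∀ a a' b b', h a b = h a' b' → a = a' ∧ b = b')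
    {f : Multiset M → Sums X} {g : Multiset M → Sums Y} {v w : Multiset M} {a : X} {b : Y}
    (huniq : ∀ v' w', v' + w' = v + w → a ∈ f v' → b ∈ g w' → v' = v) :
    coeff (conv h f g (v + w)) (h a b) =
      coeff (Multiset.antidiagonal (v + w)) (v, w) * (coeff (f v) a * coeff (g w) b) := by
  rw [conv, coeff_bind_of_unique (x := (v, w))]
  · rw [coeff_bind_of_unique (x := a), coeff_map_of_injective]
    · exact fun b b' hb => (hinj _ _ _ _ hb).2
    · intro a' _ ha'
      obtain ⟨b', -, hb'⟩ := Multiset.mem_map.1 ha'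
      exact (hinj _ _ _ _ hb').1
  · rintro ⟨v', w'⟩ hp hc
    rw [Multiset.mem_antidiagonal] at hp
    obtain ⟨a', ha', hc⟩ := Multiset.mem_bind.1 hc
    obtain ⟨b', hb', hc⟩ := Multiset.mem_map.1 hc
    obtain ⟨rfl, rfl⟩ := hinj _ _ _ _ hc
    have hv := huniq v' w' hp ha' hb'
    subst hv
    simp only at hp
    rw [add_left_cancel hp]

theorem multProd_zero (w : X → ℕ) : multProd w 0 = 1 := by simp [multProd]

/-- From `(n + 1)! = (n + 1) * n!`. This recursion replaces factorials in the later inductions. -/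
theorem multProd_cons (w : X → ℕ) (a : X) (t : Multiset X) :
    multProd w (a ::ₘ t) = coeff (a ::ₘ t) a * w a * multProd w t := by
  classical
  have key : ∀ s : Multiset X, multProd w s =
      ∏ b ∈ (a ::ₘ t).toFinset ∪ s.toFinset, (s.count b).factorial * w b ^ s.count b := by
    intro s
    unfold multProd
    refine (Finset.prod_subset (s₂ := (a ::ₘ t).toFinset ∪ s.toFinset) ?_ ?_).trans ?_
    · intro b hb
      simp only [Multiset.mem_toFinset, Finset.mem_union] at hb ⊢
      exact .inr hb
    · intro b _ hb
      rw [Multiset.mem_toFinset] at hb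
      simp [hb]
    · refine Finset.prod_congr rfl fun b _ => ?_
      convert rfl
  have hs : (a ::ₘ t).toFinset ∪ t.toFinset = (a ::ₘ t).toFinset := by
    ext b; simp
  rw [key t, key (a ::ₘ t), hs, Finset.union_self]
  have ha : a ∈ (a ::ₘ t).toFinset := by simp
  rw [← Finset.mul_prod_erase _ _ ha, ← Finset.mul_prod_erase _ _ ha, coeff_cons_self]
  have hc : coeff t a = t.count a := by unfold coeff; convert rfl
  have hprod : ∏ b ∈ (a ::ₘ t).toFinset.erase a, ((a ::ₘ t).count b).factorial *
      w b ^ (a ::ₘ t).count b =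
      ∏ b ∈ (a ::ₘ t).toFinset.erase a, (t.count b).factorial * w b ^ t.count b := by
    refine Finset.prod_congr rfl fun b hb => ?_
    rw [Multiset.count_cons_of_ne (Finset.ne_of_mem_erase hb)]
  rw [hprod, hc, Multiset.count_cons_self, Nat.factorial_succ, pow_succ]
  ring

/-- The multiplicity of a splitting is a product of binomial coefficients, and the powers of `m` add
up. The induction follows Pascal's rule: the removed element lies in `w` or in `v`, and its number
of occurrences in `u` is the sum of those in the two parts. -/
theorem coeff_antidiagonal_mul (m : X → ℕ) (u v w : Multiset X) (h : v + w = u) :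
    coeff (Multiset.antidiagonal u) (v, w) * (multProd m v * multProd m w) = multProd m u := by
  classical
  induction u using Multiset.induction generalizing v w with
  | empty =>
    have hv : v = 0 := by simpa using (add_eq_zero.1 h).1
    have hw : w = 0 := by simpa using (add_eq_zero.1 h).2
    subst hv hw
    simp [multProd_zero, coeff_singleton_self]
  | cons a u ih =>
    rw [Multiset.antidiagonal_cons, coeff_add, multProd_cons, add_mul, ← h, coeff_add, add_mul,
      add_mul, add_comm (coeff v a * m a * multProd m u)]
    congr 1
    · by_cases ha : a ∈ w
      · obtain ⟨w, rfl⟩ := Multiset.exists_cons_of_mem ha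
        have hinj : Function.Injective
            (Prod.map (id : Multiset X → Multiset X) (Multiset.cons a)) :=
          Function.injective_id.prodMap fun _ _ => (Multiset.cons_inj_right a).1
        have hc := coeff_map_of_injective hinj (Multiset.antidiagonal u) (v, w)
        rw [Multiset.add_cons, Multiset.cons_inj_right] at h
        simp only [Prod.map_apply, id_eq] at hc
        rw [hc, ← ih v w h, multProd_cons]
        ring
      · rw [coeff_eq_zero.2 ha, coeff_eq_zero.2]
        · simp
        · intro hm
          obtain ⟨⟨p, q⟩, -, hpq⟩ := Multiset.mem_map.1 hm
          simp only [Prod.map_apply, id_eq, Prod.mk.injEq] at hpq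
          exact ha (by simp [← hpq.2])
    · by_cases ha : a ∈ v
      · obtain ⟨v, rfl⟩ := Multiset.exists_cons_of_mem ha
        have hinj : Function.Injective
            (Prod.map (Multiset.cons a) (id : Multiset X → Multiset X)) :=
          Function.Injective.prodMap (fun _ _ => (Multiset.cons_inj_right a).1)
            Function.injective_id
        have hc := coeff_map_of_injective hinj (Multiset.antidiagonal u) (v, w)
        rw [Multiset.cons_add, Multiset.cons_inj_right] at h
        simp only [Prod.map_apply, id_eq] at hc
        rw [hc, ← ih v w h, multProd_cons]
        ring
      · rw [coeff_eq_zero.2 ha, coeff_eq_zero.2]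
        · simp
        · intro hm
          obtain ⟨⟨p, q⟩, -, hpq⟩ := Multiset.mem_map.1 hm
          simp only [Prod.map_apply, id_eq, Prod.mk.injEq] at hpq
          exact ha (by simp [← hpq.1])

end Coeff

/-! ### Distribution over a monomial -/

section Distrib

variable {A : Type} {f : A → Mono → Sums Term}

theorem distrib_zero_eq_unit : distrib 0 = unit 0 := by
  funext u
  by_cases h : u = 0 <;> simp [distrib, unit, h]

theorem distrib_cons (g : Mono → Sums Term) (fs : Multiset (Mono → Sums Term)) :
    distrib (g ::ₘ fs) = conv (· ::ₘ ·) g (distrib fs) := by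
  simp [distrib]; rfl

theorem exists_cons_of_map_eq_cons {B C : Type} {φ : B → C} {W : Multiset B} {c : C}
    {t : Multiset C} (h : W.map φ = c ::ₘ t) : ∃ p W', W = p ::ₘ W' ∧ φ p = c ∧ W'.map φ = t := by
  obtain ⟨p, hp, rfl⟩ := Multiset.mem_map.1 (h ▸ Multiset.mem_cons_self c t)
  obtain ⟨W, rfl⟩ := Multiset.exists_cons_of_mem hp
  rw [Multiset.map_cons, Multiset.cons_inj_right] at h
  exact ⟨p, W, rfl, rfl, h⟩

/-- The multiset `W` records, for each factor, its label, the multiset it consumed and the term it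
produced. -/
theorem mem_distrib {t : Multiset A} {u T : Mono} : T ∈ distrib (t.map f) u ↔
    ∃ W : Multiset (A × Mono × Term), W.map (fun p => p.1) = t ∧ (W.map fun p => p.2.1).sum = u ∧
      W.map (fun p => p.2.2) = T ∧ ∀ p ∈ W, p.2.2 ∈ f p.1 p.2.1 := by
  induction t using Multiset.induction generalizing u T with
  | empty =>
    rw [Multiset.map_zero, distrib_zero_eq_unit, mem_unit]
    constructor
    · rintro ⟨rfl, rfl⟩
      exact ⟨0, by simp⟩
    · rintro ⟨W, hW, rfl, rfl, -⟩
      rw [Multiset.map_eq_zero] at hW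
      simp [hW]
  | cons a t ih =>
    rw [Multiset.map_cons, distrib_cons, mem_conv]
    constructor
    · rintro ⟨v, w, e, T, rfl, he, hT, rfl⟩
      obtain ⟨W, rfl, rfl, rfl, hW⟩ := ih.1 hT
      refine ⟨(a, v, e) ::ₘ W, by simp, by simp, by simp, ?_⟩
      simpa [he] using hW
    · rintro ⟨W, hW, rfl, rfl, hm⟩
      obtain ⟨p, W, rfl, rfl, rfl⟩ := exists_cons_of_map_eq_cons hW
      exact ⟨p.2.1, _, p.2.2, _, by simp, hm p (by simp),
        ih.2 ⟨W, rfl, rfl, rfl, fun q hq => hm q (by simp [hq])⟩, by simp⟩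

/-- Since outputs determine their label and their input, a common result `T` can be decoded element
by element into the labels and the consumed parts, hence into `t` and `u`. -/
theorem distrib_coh {t t' : Multiset A} {u u' T T' : Mono} (hT : T ∈ distrib (t.map f) u)
    (hT' : T' ∈ distrib (t'.map f) u')
    (h : ∀ a ∈ t + t', ∀ b ∈ t + t', ∀ v v', (v ≤ u ∨ v ≤ u') → (v' ≤ u ∨ v' ≤ u') →
      ∀ e ∈ f a v, ∀ e' ∈ f b v', Term.Coh e e' ∧ (e = e' → a = b ∧ v = v')) :
    Mono.Coh T T' ∧ (T = T' → t = t' ∧ u = u') := by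
  classical
  obtain ⟨W, rfl, rfl, rfl, hW⟩ := mem_distrib.1 hT
  obtain ⟨W', rfl, rfl, rfl, hW'⟩ := mem_distrib.1 hT'
  have key : ∀ p ∈ W + W', ∀ q ∈ W + W',
      Term.Coh p.2.2 q.2.2 ∧ (p.2.2 = q.2.2 → p.1 = q.1 ∧ p.2.1 = q.2.1) := by
    have hle : ∀ p ∈ W + W', p.2.1 ≤ (W.map fun p => p.2.1).sum ∨
        p.2.1 ≤ (W'.map fun p => p.2.1).sum := by
      intro p hp
      refine (Multiset.mem_add.1 hp).imp (fun hp => ?_) fun hp => ?_ <;>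
        exact Multiset.single_le_sum (fun _ _ => Multiset.zero_le _) _
          (Multiset.mem_map_of_mem (fun p : A × Mono × Term => p.2.1) hp)
    have hm : ∀ p ∈ W + W', p.2.2 ∈ f p.1 p.2.1 := fun p hp =>
      (Multiset.mem_add.1 hp).elim (hW p) (hW' p)
    intro p hp q hq
    refine h p.1 ?_ q.1 ?_ _ _ (hle p hp) (hle q hq) _ (hm p hp) _ (hm q hq)
    · rw [← Multiset.map_add]; exact Multiset.mem_map_of_mem _ hp
    · rw [← Multiset.map_add]; exact Multiset.mem_map_of_mem _ hq
  constructor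
  · intro a ha b hb
    rw [← Multiset.map_add] at ha hb
    obtain ⟨p, hp, rfl⟩ := Multiset.mem_map.1 ha
    obtain ⟨q, hq, rfl⟩ := Multiset.mem_map.1 hb
    exact (key p hp q hq).1
  · intro hTT
    -- The decoding of an output; `none` is a default for terms that are not outputs. By `key` the
    -- choice of a record does not matter.
    let φ : Term → Option (A × Mono) := fun e =>
      if h : ∃ p ∈ W + W', p.2.2 = e then some (h.choose.1, h.choose.2.1) else none
    have hφ : ∀ p ∈ W + W', φ p.2.2 = some (p.1, p.2.1) := by
      intro p hp
      have hex : ∃ q ∈ W + W', q.2.2 = p.2.2 := ⟨p, hp, rfl⟩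
      have := (key _ hex.choose_spec.1 p hp).2 hex.choose_spec.2
      simp only [φ, dif_pos hex, this.1, this.2]
    have h₁ : (W.map fun p => some (p.1, p.2.1)) = W'.map fun p => some (p.1, p.2.1) := by
      have := congrArg (Multiset.map φ) hTT
      rw [Multiset.map_map, Multiset.map_map] at this
      refine Eq.trans (Multiset.map_congr rfl fun p hp => ?_)
        (this.trans (Multiset.map_congr rfl fun p hp => ?_))
      · exact (hφ p (Multiset.mem_add.2 (.inl hp))).symm
      · exact hφ p (Multiset.mem_add.2 (.inr hp))
    have h₂ : (W.map fun p => (p.1, p.2.1)) = W'.map fun p => (p.1, p.2.1) := by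
      refine Multiset.map_injective (Option.some_injective _) ?_
      simpa [Multiset.map_map] using h₁
    constructor
    · simpa [Multiset.map_map] using congrArg (Multiset.map Prod.fst) h₂
    · have := congrArg (Multiset.map Prod.snd) h₂
      simp only [Multiset.map_map, Function.comp_def] at this
      rw [this]

end Distrib

end Resource

namespace Resource

/-! ### Coefficients of a distribution -/

section Distrib

variable {A : Type} {f : A → Mono → Sums Term}

/-- In the induction, the image of the new element `a` may be any element `e` of `T` that comes from
`a`. The pair of `e` and the rest of `T` has its coefficient given by the induction hypothesis and
`coeff_antidiagonal_mul`. Summing over the possible `e`, with multiplicity, counts the occurrences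
of `a`, which is the new factor of `multProd`. -/
theorem coeff_distrib (wA : A → ℕ) (t : Multiset A) : ∀ {u T : Mono},
    (∀ a ∈ t, ∀ b ∈ t, ∀ v ≤ u, ∀ v' ≤ u, ∀ e ∈ f a v, e ∈ f b v' → a = b ∧ v = v') →
    (∀ a ∈ t, ∀ v ≤ u, ∀ e ∈ f a v, coeff (f a v) e * e.mult = wA a * Mono.mult v) →
    T ∈ distrib (t.map f) u →
    coeff (distrib (t.map f) u) T * Mono.mult T = multProd wA t * Mono.mult u := by
  classical
  induction t using Multiset.induction with
  | empty =>
    intro u T _ _ hT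
    rw [Multiset.map_zero, distrib_zero_eq_unit, mem_unit] at hT
    obtain ⟨rfl, rfl⟩ := hT
    rw [Multiset.map_zero, distrib_zero_eq_unit, unit_zero, coeff_singleton_self, multProd_zero]
  | cons a t ih =>
    intro u T hinj hco hT
    set D := distrib (t.map f) with hD
    -- `P` remembers which element of the result is the image of `a`; forgetting this gives the
    -- distribution over `a ::ₘ t`.
    set P := conv Prod.mk (f a) D u with hP
    have hterm : ∀ e ∈ T, coeff P (e, T.erase e) * Mono.mult T =
        if (e, T.erase e) ∈ P then
          T.count e * (wA a * multProd wA t * Mono.mult u) else 0 := by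
      intro e he
      split_ifs with hm
      · obtain ⟨v, w, e', T', rfl, hv, hw, hpair⟩ := mem_conv.1 hm
        obtain ⟨rfl, hT'⟩ := Prod.mk.inj hpair
        have hle : v ≤ v + w := Multiset.le_add_right v w
        have hle' : w ≤ v + w := Multiset.le_add_left w v
        have h₁ := hco a (by simp) v hle e' hv
        have h₂ := ih (u := w)
          (fun b hb c hc x hx y hy => hinj b (by simp [hb]) c (by simp [hc]) x (hx.trans hle')
            y (hy.trans hle'))
          (fun b hb x hx => hco b (by simp [hb]) x (hx.trans hle')) hw
        have h₃ := coeff_antidiagonal_mul Term.mult (v + w) v w rfl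
        have h₄ : Mono.mult T = T.count e' * e'.mult * Mono.mult T' := by
          have h := multProd_cons Term.mult e' T'
          rw [hT', Multiset.cons_erase he] at h
          simp only [Mono.mult, hT'] at h ⊢
          rw [h]
          unfold coeff
          convert rfl
        rw [← hT', hP, coeff_conv (fun _ _ _ _ h => Prod.mk.inj h), h₄]
        · have h₅ : Mono.mult (v + w) = coeff (Multiset.antidiagonal (v + w)) (v, w) *
              (Mono.mult v * Mono.mult w) := h₃.symm
          rw [h₅]
          calc _ = coeff (Multiset.antidiagonal (v + w)) (v, w) * T.count e' *
                ((coeff (f a v) e' * e'.mult) * (coeff (D w) T' * Mono.mult T')) := by ring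
            _ = _ := by rw [h₁, h₂]; ring
        · intro v' w' hvw hv' _
          exact (hinj a (by simp) a (by simp) v' (hvw ▸ Multiset.le_add_right v' w') v hle e'
            hv' hv).2
      · rw [coeff_eq_zero.2 hm, zero_mul]
    have hsum : coeff (distrib ((a ::ₘ t).map f) u) T =
        ∑ e ∈ T.toFinset, coeff P (e, T.erase e) := by
      have hmap : distrib ((a ::ₘ t).map f) u = P.map fun p => p.1 ::ₘ p.2 := by
        rw [Multiset.map_cons, distrib_cons, hP, map_conv]
      rw [hmap, coeff_map_eq_sum (F := T.toFinset.image fun e => (e, T.erase e)),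
        Finset.sum_image]
      · exact fun x _ y _ h => (Prod.mk.inj h).1
      · rintro ⟨e, T'⟩
        simp only [Finset.mem_image, Multiset.mem_toFinset, Prod.mk.injEq]
        constructor
        · rintro rfl
          exact ⟨e, by simp, rfl, by simp⟩
        · rintro ⟨_, he, rfl, rfl⟩
          exact Multiset.cons_erase he
    -- By injectivity an element of `T` is a possible image of `a` exactly when its record in `W`
    -- has label `a`, and there are as many such records as copies of `a` in `a ::ₘ t`.
    have hcount : ∑ e ∈ T.toFinset, (if (e, T.erase e) ∈ P then T.count e else 0) =
        coeff (a ::ₘ t) a := by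
      have h₁ := Finset.sum_multiset_map_count T fun e => if (e, T.erase e) ∈ P then 1 else 0
      simp only [smul_eq_mul, mul_ite, mul_one, mul_zero] at h₁
      rw [← h₁, coeff_eq_sum]
      obtain ⟨W, hW, rfl, rfl, hm⟩ := mem_distrib.1 hT
      rw [← hW, Multiset.map_map, Multiset.map_map]
      refine congrArg (fun S : Multiset ℕ => S.sum) (Multiset.map_congr rfl fun p hp => ?_)
      simp only [Function.comp_apply]
      have hle : p.2.1 ≤ (W.map fun p => p.2.1).sum :=
        Multiset.single_le_sum (fun _ _ => Multiset.zero_le _) _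
          (Multiset.mem_map_of_mem (fun p : A × Mono × Term => p.2.1) hp)
      have hiff : (p.2.2, (W.map fun p => p.2.2).erase p.2.2) ∈ P ↔ p.1 = a := by
        constructor
        · intro h
          obtain ⟨v, w, e', T', hvw, hv, -, hpair⟩ := mem_conv.1 h
          obtain ⟨rfl, -⟩ := Prod.mk.inj hpair
          refine (hinj p.1 ?_ a (by simp) _ hle v ?_ _ (hm p hp) hv).1
          · rw [← hW]; exact Multiset.mem_map_of_mem (fun p : A × Mono × Term => p.1) hp
          · rw [← hvw]; exact Multiset.le_add_right v w
        · intro h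
          obtain ⟨W, rfl⟩ := Multiset.exists_cons_of_mem hp
          rw [Multiset.map_cons, h, Multiset.cons_inj_right] at hW
          rw [hP, mem_conv]
          refine ⟨p.2.1, (W.map fun p => p.2.1).sum, p.2.2, W.map fun p => p.2.2, by simp,
            h ▸ hm p hp, ?_, by simp⟩
          exact mem_distrib.2 ⟨W, hW, rfl, rfl, fun q hq => hm q (by simp [hq])⟩
      simp only [hiff]
    rw [hsum, Finset.sum_mul, Finset.sum_congr rfl fun e he =>
      hterm e (Multiset.mem_toFinset.1 he), multProd_cons, ← hcount]
    simp only [Finset.sum_mul]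
    refine Finset.sum_congr rfl fun e _ => ?_
    split_ifs
    · ring
    · simp

end Distrib

/-! ### Coherence -/

namespace Mono

theorem coh_self_iff {t : Mono} : Mono.Coh t t ↔ ∀ a ∈ t, ∀ b ∈ t, Term.Coh a b := by
  simp [Mono.Coh]

theorem Coh.mono {u u' v v' : Mono} (h : Mono.Coh u u') (hv : v ≤ u ∨ v ≤ u')
    (hv' : v' ≤ u ∨ v' ≤ u') : Mono.Coh v v' := by
  have key : ∀ a ∈ v + v', a ∈ u + u' := by
    intro a ha
    rw [Multiset.mem_add] at ha ⊢
    rcases ha with ha | ha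
    · exact hv.imp (fun h => Multiset.mem_of_le h ha) fun h => Multiset.mem_of_le h ha
    · exact hv'.imp (fun h => Multiset.mem_of_le h ha) fun h => Multiset.mem_of_le h ha
  exact fun a ha b hb => h a (key a ha) b (key b hb)

end Mono

namespace Term

theorem coh_lam_iff {s s' : Term} : Coh (lam s) (lam s') ↔ Coh s s' := by
  refine ⟨fun h => ?_, .lam⟩
  generalize he : lam s = e at h
  generalize he' : lam s' = e' at h
  cases h <;> simp at he he'
  subst he he'
  assumption

theorem coh_app_iff {s s' : Term} {t t' : Mono} :
    Coh (app s t) (app s' t') ↔ Coh s s' ∧ Mono.Coh t t' := by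
  refine ⟨fun h => ?_, fun h => .app h.1 h.2⟩
  generalize he : app s t = e at h
  generalize he' : app s' t' = e' at h
  cases h <;> simp at he he'
  obtain ⟨rfl, rfl⟩ := he
  obtain ⟨rfl, rfl⟩ := he'
  exact ⟨by assumption, by assumption⟩

theorem coh_inl_iff {s s' : Term} : Coh (inl s) (inl s') ↔ Coh s s' := by
  refine ⟨fun h => ?_, .inl⟩
  generalize he : inl s = e at h
  generalize he' : inl s' = e' at h
  cases h <;> simp at he he'
  subst he he'
  assumption

theorem coh_inr_iff {s s' : Term} : Coh (inr s) (inr s') ↔ Coh s s' := by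
  refine ⟨fun h => ?_, .inr⟩
  generalize he : inr s = e at h
  generalize he' : inr s' = e' at h
  cases h <;> simp at he he'
  subst he he'
  assumption

theorem Coh.rename {s s' : Term} (h : Coh s s') : ∀ f, Coh (s.rename f) (s'.rename f) := by
  induction h with
  | var n => intro f; rw [rename_var]; exact .var _
  | lam _ ih => intro f; rw [rename_lam, rename_lam]; exact .lam (ih _)
  | app _ _ ih iht =>
    intro f
    rw [rename_app, rename_app]
    refine .app (ih f) fun a ha b hb => ?_
    rw [← Multiset.map_add] at ha hb
    obtain ⟨a, ha', rfl⟩ := Multiset.mem_map.1 ha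
    obtain ⟨b, hb', rfl⟩ := Multiset.mem_map.1 hb
    exact iht a ha' b hb' f
  | inl _ ih => intro f; rw [rename_inl, rename_inl]; exact .inl (ih _)
  | inr _ ih => intro f; rw [rename_inr, rename_inr]; exact .inr (ih _)
  | inl_inr => intro f; rw [rename_inl, rename_inr]; exact .inl_inr _ _
  | inr_inl => intro f; rw [rename_inl, rename_inr]; exact .inr_inl _ _

theorem _root_.Resource.Mono.Coh.map_shift {u u' : Mono} (h : Mono.Coh u u') :
    Mono.Coh (u.map shift) (u'.map shift) := by
  intro a ha b hb
  rw [← Multiset.map_add] at ha hb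
  obtain ⟨a, ha', rfl⟩ := Multiset.mem_map.1 ha
  obtain ⟨b, hb', rfl⟩ := Multiset.mem_map.1 hb
  exact (h a ha' b hb').rename _

/-- Renaming by a left inverse of `f` undoes the renaming by `f`. -/
theorem rename_injective {f : ℕ → ℕ} (hf : Function.Injective f) :
    Function.Injective fun s => rename s f := by
  have hinv := Function.leftInverse_invFun hf
  intro s s' h
  have h' := congrArg (fun s => rename s (Function.invFun f)) h
  have hid : ∀ s : Term, s.rename id = s := by
    intro s
    induction s using ind with
    | hvar n => rw [rename_var]; rfl
    | hlam s ih =>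
      have : liftRen id = id := by funext n; cases n <;> rfl
      rw [rename_lam, this, ih]
    | happ s t ih iht =>
      rw [rename_app, ih, Multiset.map_congr rfl iht, Multiset.map_id']
    | hinl s ih => rw [rename_inl, ih]
    | hinr s ih => rw [rename_inr, ih]
  have hc : Function.invFun f ∘ f = id := funext hinv
  simpa [rename_rename, hc, hid] using h'

theorem shift_injective : Function.Injective shift :=
  rename_injective Nat.succ_injective

/-- Injectivity keeps distinct elements of a monomial distinct, so that no factorial changes. -/
theorem mult_rename (s : Term) : ∀ f : ℕ → ℕ, Function.Injective f →
    (s.rename f).mult = s.mult := by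
  classical
  induction s using ind with
  | hvar n => intro f _; rw [rename_var, mult_var, mult_var]
  | hlam s ih => intro f hf; rw [rename_lam, mult_lam, mult_lam, ih _ (liftRen_injective hf)]
  | happ s t ih iht =>
    intro f hf
    rw [rename_app, mult_app, mult_app, ih f hf, Mono.mult, Mono.mult,
      multProd_map (fun a => rename a f) (rename_injective hf)]
    congr 1
    refine Finset.prod_congr rfl fun a ha => ?_
    simp only [iht a (Multiset.mem_toFinset.1 ha) f hf]
  | hinl s ih => intro f hf; rw [rename_inl, mult_inl, mult_inl, ih f hf]
  | hinr s ih => intro f hf; rw [rename_inr, mult_inr, mult_inr, ih f hf]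

theorem mult_map_shift (u : Mono) : Mono.mult (u.map shift) = Mono.mult u := by
  rw [Mono.mult, multProd_map shift shift_injective]
  simp only [shift, mult_rename _ _ Nat.succ_injective]
  rfl

/-- Substitutions into coherent terms are coherent, and disjoint unless the terms are equal. -/
theorem Coh.nsubst {s s' : Term} (h : Coh s s') : ∀ (x : ℕ) (u u' : Mono), Mono.Coh u u' →
    ∀ e ∈ s.nsubst x u, ∀ e' ∈ s'.nsubst x u', Coh e e' ∧ (e = e' → s = s' ∧ u = u') := by
  induction h with
  | var n =>
    intro x u u' hu e he e' he'
    by_cases hn : n = x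
    · subst hn
      rw [nsubst_var_self] at he he'
      split_ifs at he he' with h h'
      · obtain ⟨a, rfl⟩ := Multiset.card_eq_one.1 h
        obtain ⟨b, rfl⟩ := Multiset.card_eq_one.1 h'
        rw [Multiset.mem_singleton] at he he'
        subst he he'
        exact ⟨hu _ (by simp) _ (by simp), fun h => ⟨rfl, by rw [h]⟩⟩
      all_goals simp at he he'
    · obtain ⟨n, rfl⟩ := exists_eq_skip hn
      rw [nsubst_var_skip, mem_unit] at he he'
      rw [he.2, he'.2, he.1, he'.1]
      exact ⟨.var n, fun _ => ⟨rfl, rfl⟩⟩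
  | lam _ ih =>
    intro x u u' hu e he e' he'
    rw [nsubst_lam] at he he'
    obtain ⟨a, ha, rfl⟩ := Multiset.mem_map.1 he
    obtain ⟨b, hb, rfl⟩ := Multiset.mem_map.1 he'
    obtain ⟨h₁, h₂⟩ := ih _ _ _ hu.map_shift a ha b hb
    refine ⟨.lam h₁, fun h => ?_⟩
    obtain ⟨rfl, h₃⟩ := h₂ (lam_inj.1 h)
    exact ⟨rfl, Multiset.map_injective shift_injective h₃⟩
  | app _ _ ih iht =>
    intro x u u' hu e he e' he'
    rw [nsubst_app_eq_conv, mem_conv] at he he'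
    obtain ⟨v, w, a, T, rfl, ha, hT, rfl⟩ := he
    obtain ⟨v', w', a', T', rfl, ha', hT', rfl⟩ := he'
    obtain ⟨h₁, h₂⟩ := ih x v v' (hu.mono (.inl (Multiset.le_add_right _ _))
      (.inr (Multiset.le_add_right _ _))) a ha a' ha'
    obtain ⟨h₃, h₄⟩ := distrib_coh hT hT' fun p hp q hq y y' hy hy' =>
      iht p hp q hq x y y' (hu.mono (hy.imp (·.trans (Multiset.le_add_left _ _))
        (·.trans (Multiset.le_add_left _ _))) (hy'.imp (·.trans (Multiset.le_add_left _ _))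
        (·.trans (Multiset.le_add_left _ _))))
    refine ⟨.app h₁ h₃, fun h => ?_⟩
    rw [app_inj] at h
    obtain ⟨rfl, rfl⟩ := h₂ h.1
    obtain ⟨rfl, rfl⟩ := h₄ h.2
    exact ⟨rfl, rfl⟩
  | inl _ ih =>
    intro x u u' hu e he e' he'
    rw [nsubst_inl] at he he'
    obtain ⟨a, ha, rfl⟩ := Multiset.mem_map.1 he
    obtain ⟨b, hb, rfl⟩ := Multiset.mem_map.1 he'
    obtain ⟨h₁, h₂⟩ := ih _ _ _ hu a ha b hb
    exact ⟨.inl h₁, fun h => ⟨by rw [(h₂ (inl_inj.1 h)).1], (h₂ (inl_inj.1 h)).2⟩⟩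
  | inr _ ih =>
    intro x u u' hu e he e' he'
    rw [nsubst_inr] at he he'
    obtain ⟨a, ha, rfl⟩ := Multiset.mem_map.1 he
    obtain ⟨b, hb, rfl⟩ := Multiset.mem_map.1 he'
    obtain ⟨h₁, h₂⟩ := ih _ _ _ hu a ha b hb
    exact ⟨.inr h₁, fun h => ⟨by rw [(h₂ (inr_inj.1 h)).1], (h₂ (inr_inj.1 h)).2⟩⟩
  | inl_inr =>
    intro x u u' hu e he e' he'
    rw [nsubst_inl] at he
    rw [nsubst_inr] at he'
    obtain ⟨a, ha, rfl⟩ := Multiset.mem_map.1 he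
    obtain ⟨b, hb, rfl⟩ := Multiset.mem_map.1 he'
    exact ⟨.inl_inr _ _, fun h => by simp at h⟩
  | inr_inl =>
    intro x u u' hu e he e' he'
    rw [nsubst_inr] at he
    rw [nsubst_inl] at he'
    obtain ⟨a, ha, rfl⟩ := Multiset.mem_map.1 he
    obtain ⟨b, hb, rfl⟩ := Multiset.mem_map.1 he'
    exact ⟨.inr_inl _ _, fun h => by simp at h⟩

/-- The coefficients of a substitution into a uniform term. -/
theorem coeff_nsubst (s : Term) : Coh s s → ∀ (x : ℕ) (u : Mono), Mono.Coh u u →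
    ∀ e ∈ s.nsubst x u, coeff (s.nsubst x u) e * e.mult = s.mult * Mono.mult u := by
  induction s using ind with
  | hvar n =>
    intro _ x u hu e he
    by_cases hn : n = x
    · subst hn
      rw [nsubst_var_self] at he ⊢
      split_ifs at he ⊢ with h
      · obtain ⟨a, rfl⟩ := Multiset.card_eq_one.1 h
        rw [Multiset.mem_singleton] at he
        subst he
        rw [coeff_singleton_self, mult_var, Mono.mult, ← Multiset.cons_zero, multProd_cons,
          multProd_zero, Multiset.cons_zero, coeff_singleton_self]
        ring
      · simp at he
    · obtain ⟨n, rfl⟩ := exists_eq_skip hn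
      rw [nsubst_var_skip, mem_unit] at he
      rw [nsubst_var_skip, he.2, he.1, unit_zero, coeff_singleton_self, mult_var, mult_var,
        Mono.mult, multProd_zero]
  | hlam s ih =>
    intro hs x u hu e he
    rw [nsubst_lam] at he ⊢
    obtain ⟨a, ha, rfl⟩ := Multiset.mem_map.1 he
    rw [coeff_map_of_injective fun _ _ => lam_inj.1, mult_lam, mult_lam,
      ih (coh_lam_iff.1 hs) _ _ hu.map_shift a ha, mult_map_shift]
  | happ s t ih iht =>
    intro hs x u hu e he
    obtain ⟨hs, ht⟩ := coh_app_iff.1 hs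
    rw [Mono.coh_self_iff] at ht
    rw [nsubst_app_eq_conv] at he ⊢
    obtain ⟨v, w, a, T, rfl, ha, hT, rfl⟩ := mem_conv.1 he
    have hv : v ≤ v + w := Multiset.le_add_right _ _
    have hw : w ≤ v + w := Multiset.le_add_left _ _
    have h₁ := ih hs x v (hu.mono (.inl hv) (.inl hv)) a ha
    have h₂ : coeff (Mono.nsubst t x w) T * Mono.mult T = Mono.mult t * Mono.mult w := by
      refine coeff_distrib mult t ?_ ?_ hT
      · intro p hp q hq y hy y' hy' e he he'
        exact ((ht p hp q hq).nsubst x y y'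
          (hu.mono (.inl (hy.trans hw)) (.inl (hy'.trans hw))) e he e he').2 rfl
      · intro p hp y hy
        exact iht p hp (ht p hp p hp) x y (hu.mono (.inl (hy.trans hw)) (.inl (hy.trans hw)))
    have h₃ : coeff (Multiset.antidiagonal (v + w)) (v, w) * (Mono.mult v * Mono.mult w) =
      Mono.mult (v + w) := coeff_antidiagonal_mul mult (v + w) v w rfl
    -- The share of `u` that went into `s` can be read off `a` by `Coh.nsubst`, so a single
    -- splitting contributes.
    rw [coeff_conv fun _ _ _ _ h => app_inj.1 h, mult_app, mult_app, ← h₃]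
    · calc _ = coeff (Multiset.antidiagonal (v + w)) (v, w) *
            ((coeff (s.nsubst x v) a * a.mult) *
              (coeff (Mono.nsubst t x w) T * Mono.mult T)) := by ring
        _ = _ := by rw [h₁, h₂]; ring
    · intro v' w' hvw hv' _
      have hle : v' ≤ v + w := hvw ▸ Multiset.le_add_right v' w'
      exact (hs.nsubst x v' v (hu.mono (.inl hle) (.inl hv)) a hv' a ha).2 rfl |>.2
  | hinl s ih =>
    intro hs x u hu e he
    rw [nsubst_inl] at he ⊢
    obtain ⟨a, ha, rfl⟩ := Multiset.mem_map.1 he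
    rw [coeff_map_of_injective fun _ _ => inl_inj.1, mult_inl, mult_inl,
      ih (coh_inl_iff.1 hs) x u hu a ha]
  | hinr s ih =>
    intro hs x u hu e he
    rw [nsubst_inr] at he ⊢
    obtain ⟨a, ha, rfl⟩ := Multiset.mem_map.1 he
    rw [coeff_map_of_injective fun _ _ => inr_inj.1, mult_inr, mult_inr,
      ih (coh_inr_iff.1 hs) x u hu a ha]

end Term

end Resource

namespace Resource

namespace Term

/-! ### Parallel reduction -/

/-- The term `λ s`, with an outermost choice of `s` moved outwards. -/
noncomputable def pushLam (s : Term) : Term :=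
  match QPF.Fix.dest s with
  | .inl s₀ => inl (lam s₀)
  | .inr s₀ => inr (lam s₀)
  | _ => lam s

@[simp] theorem pushLam_var (n : ℕ) : pushLam (var n) = lam (var n) := by
  simp [pushLam, var, QPF.Fix.dest_mk]
@[simp] theorem pushLam_lam (s : Term) : pushLam (lam s) = lam (lam s) := by
  simp [pushLam, lam, QPF.Fix.dest_mk]
@[simp] theorem pushLam_app (s : Term) (t : Mono) : pushLam (app s t) = lam (app s t) := by
  simp [pushLam, app, QPF.Fix.dest_mk]
@[simp] theorem pushLam_inl (s : Term) : pushLam (inl s) = inl (lam s) := by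
  simp [pushLam, inl, QPF.Fix.dest_mk]
@[simp] theorem pushLam_inr (s : Term) : pushLam (inr s) = inr (lam s) := by
  simp [pushLam, inr, QPF.Fix.dest_mk]

/-- The application of `s` to `t`, with the outermost redex contracted if there is one. -/
noncomputable def applySum (s : Term) (t : Mono) : Sums Term :=
  match QPF.Fix.dest s with
  | .lam s₀ => nsubst s₀ 0 t
  | .inl s₀ => {inl (app s₀ t)}
  | .inr s₀ => {inr (app s₀ t)}
  | _ => {app s t}

@[simp] theorem applySum_var (n : ℕ) (t : Mono) : applySum (var n) t = {app (var n) t} := by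
  simp [applySum, var, QPF.Fix.dest_mk]
@[simp] theorem applySum_lam (s : Term) (t : Mono) : applySum (lam s) t = s.nsubst 0 t := by
  simp [applySum, lam, QPF.Fix.dest_mk]
@[simp] theorem applySum_app (s : Term) (t t' : Mono) :
    applySum (app s t) t' = {app (app s t) t'} := by
  simp [applySum, app, QPF.Fix.dest_mk]
@[simp] theorem applySum_inl (s : Term) (t : Mono) :
    applySum (inl s) t = {inl (app s t)} := by
  simp [applySum, inl, QPF.Fix.dest_mk]
@[simp] theorem applySum_inr (s : Term) (t : Mono) :
    applySum (inr s) t = {inr (app s t)} := by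
  simp [applySum, inr, QPF.Fix.dest_mk]

/-- A parallel reduction of a term. -/
noncomputable def develop : Term → Sums Term :=
  QPF.Fix.rec fun l : Layer (Sums Term) =>
    match l with
    | .var n => {var n}
    | .lam S => S.map pushLam
    -- Distributing the empty multiset over constant functions amounts to choosing one term in the
    -- development of each element of the monomial. The root is contracted after the subterms, so
    -- redexes created there are contracted too.
    | .app S T => S.bind fun s => (distrib (T.map fun E _ => E) 0).bind (applySum s)
    | .inl S => S.map inl
    | .inr S => S.map inr

end Term

/-- A parallel reduction of a monomial. -/
noncomputable def Mono.develop (t : Mono) : Sums Mono :=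
  distrib (t.map fun a _ => a.develop) 0

theorem Mono.develop_zero : Mono.develop 0 = {0} := by
  rw [Mono.develop, Multiset.map_zero, distrib_zero_eq_unit, unit_zero]

theorem Mono.develop_cons (a : Term) (t : Mono) :
    Mono.develop (a ::ₘ t) = a.develop.bind fun e => t.develop.map (e ::ₘ ·) := by
  rw [Mono.develop, Multiset.map_cons, distrib_cons, conv_zero]
  rfl

namespace Term

theorem develop_var (n : ℕ) : (var n).develop = {var n} := by
  simp only [develop, var, QPF.Fix.rec_eq]; rfl
theorem develop_lam (s : Term) : (lam s).develop = s.develop.map pushLam := by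
  simp only [develop, lam, QPF.Fix.rec_eq]; rfl
theorem develop_app (s : Term) (t : Mono) :
    (app s t).develop = s.develop.bind fun s' => t.develop.bind (applySum s') := by
  simp only [develop, app, QPF.Fix.rec_eq]
  simp [Functor.map, Layer.map, Mono.develop, develop]
theorem develop_inl (s : Term) : (inl s).develop = s.develop.map inl := by
  simp only [develop, inl, QPF.Fix.rec_eq]; rfl
theorem develop_inr (s : Term) : (inr s).develop = s.develop.map inr := by
  simp only [develop, inr, QPF.Fix.rec_eq]; rfl

theorem reds_pushLam (s : Term) : SumReds Red {lam s} {pushLam s} := by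
  induction s using ind with
  | hinl s => rw [pushLam_inl]; exact .of_red (.lam_inl s)
  | hinr s => rw [pushLam_inr]; exact .of_red (.lam_inr s)
  | _ => simp [Relation.ReflTransGen.refl]

theorem reds_applySum (s : Term) (t : Mono) : SumReds Red {app s t} (applySum s t) := by
  induction s using ind with
  | hlam s => rw [applySum_lam]; exact .of_red (.beta s t)
  | hinl s => rw [applySum_inl]; exact .of_red (.app_inl s t)
  | hinr s => rw [applySum_inr]; exact .of_red (.app_inr s t)
  | _ => simp [Relation.ReflTransGen.refl]

theorem reds_develop_mono {t : Mono} (h : ∀ a ∈ t, SumReds Red {a} a.develop) :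
    SumReds Mono.Red {t} t.develop := by
  induction t using Multiset.induction with
  | empty => rw [Mono.develop_zero]
  | cons a t ih =>
    rw [Mono.develop_cons]
    have h₁ := (h a (by simp)).map (f := fun e => e ::ₘ t) fun e S he => Mono.Red.mk t he
    rw [Multiset.map_singleton] at h₁
    refine h₁.trans (SumReds.map_bind fun e _ => ?_)
    have h₂ := (ih fun b hb => h b (by simp [hb])).map (f := fun T => e ::ₘ T)
      fun T S hT => Mono.Red.cons e hT
    rwa [Multiset.map_singleton] at h₂

theorem reds_develop (s : Term) : SumReds Red {s} s.develop := by
  induction s using ind with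
  | hvar n => rw [develop_var]
  | hlam s ih =>
    rw [develop_lam]
    have h := ih.map (f := lam) fun e S he => Red.lam he
    rw [Multiset.map_singleton] at h
    refine h.trans ?_
    rw [← Multiset.bind_singleton _ pushLam]
    exact SumReds.map_bind fun e _ => reds_pushLam e
  | happ s t ih iht =>
    rw [develop_app]
    have h := ih.map (f := fun s' => app s' t) fun e S he => Red.app_left t he
    rw [Multiset.map_singleton] at h
    refine h.trans (SumReds.map_bind fun e _ => ?_)
    have h' := (reds_develop_mono iht).map (f := app e) fun T S hT => Red.app_mono hT
    rw [Multiset.map_singleton] at h'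
    exact h'.trans (SumReds.map_bind fun T _ => reds_applySum e T)
  | hinl s ih =>
    rw [develop_inl]
    have h := ih.map (f := inl) fun e S he => Red.inl he
    rwa [Multiset.map_singleton] at h
  | hinr s ih =>
    rw [develop_inr]
    have h := ih.map (f := inr) fun e S he => Red.inr he
    rwa [Multiset.map_singleton] at h

theorem exists_weight_le {E E' : Sums Term} (h : SumReds Red E E') :
    ∀ e' ∈ E', ∃ e ∈ E, e'.weight ≤ e.weight := by
  induction h with
  | refl => exact fun e' he' => ⟨e', he', le_rfl⟩
  | tail _ h ih =>
    obtain @⟨e, S, F, h⟩ := h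
    intro e' he'
    rcases Multiset.mem_add.1 he' with he' | he'
    · obtain ⟨e₀, he₀, hle⟩ := ih e (by simp)
      exact ⟨e₀, he₀, (h.weight_lt e' he').le.trans hle⟩
    · exact ih e' (by simp [he'])

theorem weight_le_of_reds {s : Term} {E : Sums Term} (h : SumReds Red {s} E) {e : Term}
    (he : e ∈ E) : e.weight ≤ s.weight := by
  obtain ⟨e', he', hle⟩ := exists_weight_le h e he
  rwa [Multiset.mem_singleton.1 he'] at hle

theorem weight_le_of_mem_develop_mono {t T : Mono} (hT : T ∈ t.develop) :
    T.weight ≤ t.weight := by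
  induction t using Multiset.induction generalizing T with
  | empty => rw [Mono.develop_zero, Multiset.mem_singleton] at hT; rw [hT]
  | cons a t ih =>
    rw [Mono.develop_cons] at hT
    obtain ⟨e, he, hT⟩ := Multiset.mem_bind.1 hT
    obtain ⟨T, hT', rfl⟩ := Multiset.mem_map.1 hT
    rw [Mono.weight_cons, Mono.weight_cons]
    exact Nat.mul_le_mul (weight_le_of_reds (reds_develop a) he) (ih hT')

theorem weight_applySum_le {s e : Term} {t : Mono} (he : e ∈ applySum s t) :
    e.weight ≤ (app s t).weight :=
  weight_le_of_reds (reds_applySum s t) he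

/-- Some redex is contracted on every branch. A redex at the root of an application survives the
development of its subterms and is contracted by `applySum`; for an inner redex, the induction gives
a strict decrease in a subterm and positivity of the weights carries it outwards. -/
theorem weight_lt_of_mem_develop (s : Term) : ∀ S, Red s S → ∀ e ∈ s.develop,
    e.weight < s.weight := by
  induction s using ind with
  | hvar n => exact fun S h => absurd h not_red_var
  | hlam s ih =>
    intro S h e he
    rw [develop_lam] at he
    obtain ⟨a, ha, rfl⟩ := Multiset.mem_map.1 he
    have hle := weight_le_of_reds (reds_develop s) ha
    rcases red_lam_iff.1 h with ⟨p, rfl, rfl⟩ | ⟨p, rfl, rfl⟩ | ⟨S, h', rfl⟩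
    · rw [develop_inl] at ha
      obtain ⟨b, -, rfl⟩ := Multiset.mem_map.1 ha
      simp only [pushLam_inl, weight_inl, weight_lam] at hle ⊢
      omega
    · rw [develop_inr] at ha
      obtain ⟨b, -, rfl⟩ := Multiset.mem_map.1 ha
      simp only [pushLam_inr, weight_inr, weight_lam] at hle ⊢
      omega
    · have h₁ := ih S h' a ha
      have h₂ := weight_le_of_reds (reds_pushLam a) (Multiset.mem_singleton_self _)
      rw [weight_lam] at h₂ ⊢
      omega
  | happ s t ih iht =>
    intro S h e he
    rw [develop_app] at he
    obtain ⟨s', hs', he⟩ := Multiset.mem_bind.1 he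
    obtain ⟨t', ht', he⟩ := Multiset.mem_bind.1 he
    have h₁ := weight_le_of_reds (reds_develop s) hs'
    have h₂ := weight_le_of_mem_develop_mono ht'
    have h₃ := weight_applySum_le he
    have h₄ : (app s' t').weight ≤ (app s t).weight := by
      rw [weight_app, weight_app]
      gcongr
    have hpos := Mono.weight_pos t
    have hpos' := Mono.weight_pos t'
    have hs := s.weight_pos
    rcases red_app_iff.1 h with ⟨p, rfl, rfl⟩ | ⟨p, rfl, rfl⟩ | ⟨p, rfl, rfl⟩ | ⟨S, h', rfl⟩ |
      ⟨a, t, A, rfl, h', rfl⟩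
    · refine lt_of_lt_of_le ?_ h₄
      rw [develop_lam] at hs'
      obtain ⟨q, -, rfl⟩ := Multiset.mem_map.1 hs'
      -- The developed body may begin with a choice, which `pushLam` moves out; the root is then a
      -- choice redex instead of a β-redex.
      induction q using ind with
      | hinl q =>
        rw [pushLam_inl, applySum_inl] at he
        rw [pushLam_inl]
        exact (Red.app_inl _ _).weight_lt e he
      | hinr q =>
        rw [pushLam_inr, applySum_inr] at he
        rw [pushLam_inr]
        exact (Red.app_inr _ _).weight_lt e he
      | _ =>
        simp only [pushLam_var, pushLam_lam, pushLam_app, applySum_lam] at he ⊢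
        exact weight_beta he
    · refine lt_of_lt_of_le ?_ h₄
      rw [develop_inl] at hs'
      obtain ⟨q, -, rfl⟩ := Multiset.mem_map.1 hs'
      rw [applySum_inl] at he
      exact (Red.app_inl _ _).weight_lt e he
    · refine lt_of_lt_of_le ?_ h₄
      rw [develop_inr] at hs'
      obtain ⟨q, -, rfl⟩ := Multiset.mem_map.1 hs'
      rw [applySum_inr] at he
      exact (Red.app_inr _ _).weight_lt e he
    · refine lt_of_le_of_lt h₃ ?_
      have h₅ := ih S h' s' hs'
      rw [weight_app, weight_app]
      calc 2 * s'.weight * t'.weight ≤ 2 * s'.weight * t.weight := by gcongr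
        _ < 2 * s.weight * t.weight := by gcongr
    · refine lt_of_le_of_lt h₃ ?_
      have h₅ : t'.weight < Mono.weight (a ::ₘ t) := by
        rw [Mono.develop_cons] at ht'
        obtain ⟨b, hb, ht'⟩ := Multiset.mem_bind.1 ht'
        obtain ⟨T, hT, rfl⟩ := Multiset.mem_map.1 ht'
        have h₆ := iht a (by simp) A h' b hb
        have h₇ := weight_le_of_mem_develop_mono hT
        have h₈ := Mono.weight_pos t
        rw [Mono.weight_cons, Mono.weight_cons]
        calc b.weight * Mono.weight T ≤ b.weight * Mono.weight t := by gcongr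
          _ < a.weight * Mono.weight t := by gcongr
      rw [weight_app, weight_app]
      calc 2 * s'.weight * t'.weight ≤ 2 * s.weight * t'.weight := by gcongr
        _ < 2 * s.weight * Mono.weight (a ::ₘ t) := by gcongr
  | hinl s ih =>
    intro S h e he
    obtain ⟨S, h', rfl⟩ := red_inl_iff.1 h
    rw [develop_inl] at he
    obtain ⟨a, ha, rfl⟩ := Multiset.mem_map.1 he
    have := ih S h' a ha
    rw [weight_inl, weight_inl]
    omega
  | hinr s ih =>
    intro S h e he
    obtain ⟨S, h', rfl⟩ := red_inr_iff.1 h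
    rw [develop_inr] at he
    obtain ⟨a, ha, rfl⟩ := Multiset.mem_map.1 he
    have := ih S h' a ha
    rw [weight_inr, weight_inr]
    omega

/-! ### Parallel reduction of uniform terms -/

/-- An abstraction is a value only when its body is not a choice, and a choice is a value only at
the matching choice. -/
theorem pushLam_injective : Function.Injective pushLam := by
  intro s s' h
  induction s using ind <;> induction s' using ind <;> simp_all

theorem Coh.pushLam {s s' : Term} (h : Coh s s') : Coh (pushLam s) (pushLam s') := by
  cases h with
  | var n => simpa using Coh.lam (.var n)
  | lam h => simpa using Coh.lam (.lam h)
  | app h ht => simpa using Coh.lam (.app h ht)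
  | inl h => simpa using Coh.inl (.lam h)
  | inr h => simpa using Coh.inr (.lam h)
  | inl_inr => simpa using Coh.inl_inr _ _
  | inr_inl => simpa using Coh.inr_inl _ _

theorem mult_pushLam (s : Term) : (pushLam s).mult = s.mult := by
  induction s using ind <;> simp [mult_lam, mult_inl, mult_inr]

/-- Coherent functions have the same head, or are opposite choices, whose results stay opposite and
distinct. For β the claim is `Coh.nsubst`. -/
theorem Coh.applySum {s s' : Term} {t t' : Mono} (h : Coh s s') (ht : Mono.Coh t t') :
    ∀ e ∈ applySum s t, ∀ e' ∈ applySum s' t',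
      Coh e e' ∧ (e = e' → s = s' ∧ t = t') := by
  intro e he e' he'
  cases h with
  | var n =>
    simp only [applySum_var, Multiset.mem_singleton] at he he'
    subst he he'
    exact ⟨.app (.var n) ht, app_inj.1⟩
  | lam h =>
    rw [applySum_lam] at he he'
    rw [lam_inj]
    exact h.nsubst 0 t t' ht e he e' he'
  | app h h' =>
    simp only [applySum_app, Multiset.mem_singleton] at he he'
    subst he he'
    exact ⟨.app (.app h h') ht, app_inj.1⟩
  | inl h =>
    simp only [applySum_inl, Multiset.mem_singleton] at he he'
    subst he he'
    rw [inl_inj, inl_inj]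
    exact ⟨.inl (.app h ht), app_inj.1⟩
  | inr h =>
    simp only [applySum_inr, Multiset.mem_singleton] at he he'
    subst he he'
    rw [inr_inj, inr_inj]
    exact ⟨.inr (.app h ht), app_inj.1⟩
  | inl_inr =>
    simp only [applySum_inl, applySum_inr, Multiset.mem_singleton] at he he'
    subst he he'
    exact ⟨.inl_inr _ _, fun h => by simp at h⟩
  | inr_inl =>
    simp only [applySum_inl, applySum_inr, Multiset.mem_singleton] at he he'
    subst he he'
    exact ⟨.inr_inl _ _, fun h => by simp at h⟩

theorem coeff_applySum {s : Term} {t : Mono} (h : Coh s s) (ht : Mono.Coh t t) :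
    ∀ e ∈ applySum s t, coeff (applySum s t) e * e.mult = s.mult * Mono.mult t := by
  intro e he
  induction s using ind with
  | hlam s =>
    rw [applySum_lam] at he ⊢
    rw [coeff_nsubst s (coh_lam_iff.1 h) 0 t ht e he, mult_lam]
  | _ =>
    simp only [applySum_var, applySum_app, applySum_inl, applySum_inr,
      Multiset.mem_singleton] at he ⊢
    subst he
    simp [coeff_singleton_self, mult_app, mult_inl, mult_inr]

/-- Coherent terms are contracted at matching places, which is what a single step cannot do. -/
theorem Coh.develop {s s' : Term} (h : Coh s s') : ∀ e ∈ s.develop, ∀ e' ∈ s'.develop,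
    Coh e e' ∧ (e = e' → s = s') := by
  induction h with
  | var n =>
    intro e he e' he'
    rw [develop_var, Multiset.mem_singleton] at he he'
    subst he he'
    exact ⟨.var n, fun _ => rfl⟩
  | lam _ ih =>
    intro e he e' he'
    rw [develop_lam] at he he'
    obtain ⟨a, ha, rfl⟩ := Multiset.mem_map.1 he
    obtain ⟨b, hb, rfl⟩ := Multiset.mem_map.1 he'
    obtain ⟨h₁, h₂⟩ := ih a ha b hb
    exact ⟨h₁.pushLam, fun h => by rw [h₂ (pushLam_injective h)]⟩
  | app _ _ ih iht =>
    intro e he e' he'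
    rw [develop_app] at he he'
    obtain ⟨a, ha, he⟩ := Multiset.mem_bind.1 he
    obtain ⟨T, hT, he⟩ := Multiset.mem_bind.1 he
    obtain ⟨b, hb, he'⟩ := Multiset.mem_bind.1 he'
    obtain ⟨T', hT', he'⟩ := Multiset.mem_bind.1 he'
    obtain ⟨h₁, h₂⟩ := ih a ha b hb
    -- Here nothing is distributed, so the consumed parts `y` and `y'` are both empty.
    obtain ⟨h₃, h₄⟩ := distrib_coh hT hT' fun p hp q hq y y' hy hy' x hx x' hx' =>
      ⟨(iht p hp q hq x hx x' hx').1, fun h => ⟨(iht p hp q hq x hx x' hx').2 h, by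
        have hy : y = 0 := by simpa using hy
        have hy' : y' = 0 := by simpa using hy'
        rw [hy, hy']⟩⟩
    obtain ⟨h₅, h₆⟩ := h₁.applySum h₃ e he e' he'
    exact ⟨h₅, fun h => by rw [h₂ (h₆ h).1, (h₄ (h₆ h).2).1]⟩
  | inl _ ih =>
    intro e he e' he'
    rw [develop_inl] at he he'
    obtain ⟨a, ha, rfl⟩ := Multiset.mem_map.1 he
    obtain ⟨b, hb, rfl⟩ := Multiset.mem_map.1 he'
    obtain ⟨h₁, h₂⟩ := ih a ha b hb
    exact ⟨.inl h₁, fun h => by rw [h₂ (inl_inj.1 h)]⟩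
  | inr _ ih =>
    intro e he e' he'
    rw [develop_inr] at he he'
    obtain ⟨a, ha, rfl⟩ := Multiset.mem_map.1 he
    obtain ⟨b, hb, rfl⟩ := Multiset.mem_map.1 he'
    obtain ⟨h₁, h₂⟩ := ih a ha b hb
    exact ⟨.inr h₁, fun h => by rw [h₂ (inr_inj.1 h)]⟩
  | inl_inr =>
    intro e he e' he'
    rw [develop_inl] at he
    rw [develop_inr] at he'
    obtain ⟨a, ha, rfl⟩ := Multiset.mem_map.1 he
    obtain ⟨b, hb, rfl⟩ := Multiset.mem_map.1 he'
    exact ⟨.inl_inr _ _, fun h => by simp at h⟩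
  | inr_inl =>
    intro e he e' he'
    rw [develop_inr] at he
    rw [develop_inl] at he'
    obtain ⟨a, ha, rfl⟩ := Multiset.mem_map.1 he
    obtain ⟨b, hb, rfl⟩ := Multiset.mem_map.1 he'
    exact ⟨.inr_inl _ _, fun h => by simp at h⟩

theorem coh_develop_mono {t t' : Mono} (h : Mono.Coh t t') {T T' : Mono} (hT : T ∈ t.develop)
    (hT' : T' ∈ t'.develop) : Mono.Coh T T' ∧ (T = T' → t = t') := by
  obtain ⟨h₁, h₂⟩ := distrib_coh hT hT' fun p hp q hq y y' hy hy' x hx x' hx' =>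
    ⟨((h p hp q hq).develop x hx x' hx').1, fun h' =>
      ⟨((h p hp q hq).develop x hx x' hx').2 h', by
        have hy : y = 0 := by simpa using hy
        have hy' : y' = 0 := by simpa using hy'
        rw [hy, hy']⟩⟩
  exact ⟨h₁, fun h => (h₂ h).1⟩

/-- For an application, `e` determines the developed function and monomial it came from, so three
coefficients multiply and the intermediate multiplicities cancel. -/
theorem coeff_develop (s : Term) : Coh s s → ∀ e ∈ s.develop,
    coeff s.develop e * e.mult = s.mult := by
  induction s using ind with
  | hvar n =>
    intro _ e he
    rw [develop_var] at he ⊢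
    rw [Multiset.mem_singleton.1 he, coeff_singleton_self, one_mul]
  | hlam s ih =>
    intro h e he
    rw [develop_lam] at he ⊢
    obtain ⟨a, ha, rfl⟩ := Multiset.mem_map.1 he
    rw [coeff_map_of_injective pushLam_injective, mult_pushLam, mult_lam,
      ih (coh_lam_iff.1 h) a ha]
  | happ s t ih iht =>
    intro h e he
    obtain ⟨hs, ht⟩ := coh_app_iff.1 h
    rw [develop_app] at he ⊢
    obtain ⟨a, ha, he⟩ := Multiset.mem_bind.1 he
    obtain ⟨T, hT, he⟩ := Multiset.mem_bind.1 he
    have hcoh : ∀ b ∈ s.develop, ∀ T' ∈ t.develop, e ∈ applySum b T' → b = a ∧ T' = T :=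
      fun b hb T' hT' he' => ((hs.develop b hb a ha).1.applySum (coh_develop_mono ht hT' hT).1
        e he' e he).2 rfl
    rw [coeff_bind_of_unique (x := a), coeff_bind_of_unique (x := T)]
    · have h₁ := ih hs a ha
      have h₂ : coeff t.develop T * Mono.mult T = Mono.mult t := by
        have h := coeff_distrib mult t (f := fun a _ => a.develop) (u := 0) ?_ ?_ hT
        · rwa [show Mono.mult 0 = 1 from multProd_zero _, mul_one] at h
        · intro p hp q hq y hy y' hy' x hx hx'
          refine ⟨((Mono.coh_self_iff.1 ht p hp q hq).develop x hx x hx').2 rfl, ?_⟩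
          rw [nonpos_iff_eq_zero.1 hy, nonpos_iff_eq_zero.1 hy']
        · intro p hp y hy x hx
          rw [nonpos_iff_eq_zero.1 hy, show Mono.mult 0 = 1 from multProd_zero _, mul_one]
          exact iht p hp (Mono.coh_self_iff.1 ht p hp p hp) x hx
      have h₃ := coeff_applySum (hs.develop a ha a ha).1 (coh_develop_mono ht hT hT).1 e he
      rw [mult_app, ← h₁, ← h₂]
      calc _ = coeff s.develop a * (coeff t.develop T * (coeff (applySum a T) e * e.mult)) := by
            ring
        _ = _ := by rw [h₃]; ring
    · exact fun T' hT' he' => (hcoh a ha T' hT' he').2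
    · intro b hb hb'
      obtain ⟨T', hT', he'⟩ := Multiset.mem_bind.1 hb'
      exact (hcoh b hb T' hT' he').1
  | hinl s ih =>
    intro h e he
    rw [develop_inl] at he ⊢
    obtain ⟨a, ha, rfl⟩ := Multiset.mem_map.1 he
    rw [coeff_map_of_injective fun _ _ => inl_inj.1, mult_inl, mult_inl,
      ih (coh_inl_iff.1 h) a ha]
  | hinr s ih =>
    intro h e he
    rw [develop_inr] at he ⊢
    obtain ⟨a, ha, rfl⟩ := Multiset.mem_map.1 he
    rw [coeff_map_of_injective fun _ _ => inr_inj.1, mult_inr, mult_inr,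
      ih (coh_inr_iff.1 h) a ha]

/-! ### Normal forms of uniform expressions -/

theorem NF_eq_bind_develop (s : Term) : s.NF = s.develop.bind NF :=
  nf_eq_bind exists_converges_red (reds_develop s)

theorem NF_eq_self {s : Term} (h : ∀ S, ¬ Red s S) : s.NF = {s} := by
  have hN : Normal Red {s} := normal_iff.2 fun x hx => by
    rwa [Multiset.mem_singleton.1 hx]
  exact (hN.eq_of_sumReds ((converges_nf exists_converges_red s).2 _ .refl)).symm

theorem weight_le_of_mem_develop {s e : Term} (he : e ∈ s.develop) : e.weight ≤ s.weight :=
  weight_le_of_reds (reds_develop s) he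

/-- Normal forms of coherent terms are coherent, and disjoint unless the terms are equal. -/
theorem Coh.NF {s s' : Term} (h : Coh s s') : ∀ e ∈ s.NF, ∀ e' ∈ s'.NF,
    Coh e e' ∧ (e = e' → s = s') := by
  induction hn : s.weight + s'.weight using Nat.strong_induction_on generalizing s s' with
  | _ n ih =>
    subst hn
    intro e he e' he'
    by_cases hred : (∃ S, Red s S) ∨ ∃ S, Red s' S
    · rw [NF_eq_bind_develop] at he he'
      obtain ⟨a, ha, he⟩ := Multiset.mem_bind.1 he
      obtain ⟨b, hb, he'⟩ := Multiset.mem_bind.1 he'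
      -- Both terms are developed even when only one of them reduces: one weight drops and the other
      -- does not grow.
      have hlt : a.weight + b.weight < s.weight + s'.weight := by
        have h₁ := weight_le_of_mem_develop ha
        have h₂ := weight_le_of_mem_develop hb
        rcases hred with ⟨S, hS⟩ | ⟨S, hS⟩
        · have := weight_lt_of_mem_develop s S hS a ha
          omega
        · have := weight_lt_of_mem_develop s' S hS b hb
          omega
      obtain ⟨h₁, h₂⟩ := h.develop a ha b hb
      obtain ⟨h₃, h₄⟩ := ih _ hlt h₁ rfl e he e' he'
      exact ⟨h₃, fun h => h₂ (h₄ h)⟩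
    · push Not at hred
      rw [NF_eq_self hred.1, Multiset.mem_singleton] at he
      rw [NF_eq_self hred.2, Multiset.mem_singleton] at he'
      rw [he, he']
      exact ⟨h, id⟩

/-- The coefficients of `develop` and of the next normal forms multiply, and the multiplicity of the
intermediate term cancels. That term is unique, because distinct coherent terms have disjoint normal
forms. -/
theorem coeff_NF {s : Term} (h : Coh s s) : ∀ e ∈ s.NF, coeff s.NF e * e.mult = s.mult := by
  induction hn : s.weight using Nat.strong_induction_on generalizing s with
  | _ n ih =>
    subst hn
    intro e he
    by_cases hred : ∃ S, Red s S
    · obtain ⟨S, hS⟩ := hred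
      rw [NF_eq_bind_develop] at he ⊢
      obtain ⟨a, ha, he⟩ := Multiset.mem_bind.1 he
      rw [coeff_bind_of_unique (x := a), mul_assoc,
        ih _ (weight_lt_of_mem_develop s S hS a ha) (h.develop a ha a ha).1 rfl e he,
        coeff_develop s h a ha]
      exact fun b hb he' => ((h.develop b hb a ha).1.NF e he' e he).2 rfl
    · push Not at hred
      rw [NF_eq_self hred] at he ⊢
      rw [Multiset.mem_singleton.1 he, coeff_singleton_self, one_mul]

theorem mult_pos (s : Term) : 0 < s.mult := by
  induction s using ind with
  | hvar n => rw [mult_var]; exact one_pos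
  | hlam s ih => rwa [mult_lam]
  | happ s t ih iht =>
    classical
    rw [mult_app, Mono.mult, multProd]
    refine Nat.mul_pos ih (Finset.prod_pos fun a ha => ?_)
    exact Nat.mul_pos (Nat.factorial_pos _) (pow_pos (iht a (Multiset.mem_toFinset.1 ha)) _)
  | hinl s ih => rwa [mult_inl]
  | hinr s ih => rwa [mult_inr]

end Term

/-! ### From terms to monomials -/

namespace Mono

open Term

theorem app_var_injective : Function.Injective (app (var 0)) := fun _ _ h => (app_inj.1 h).2

/-- A variable in function position neither reduces nor forms a redex at the root, so every step
takes place in the monomial. -/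
theorem red_app_var {t : Mono} {S : Sums Term} (h : Term.Red (app (var 0) t) S) :
    ∃ T, Mono.Red t T ∧ S = T.map (app (var 0)) := by
  rcases red_app_iff.1 h with ⟨p, hp, -⟩ | ⟨p, hp, -⟩ | ⟨p, hp, -⟩ | ⟨S, hS, -⟩ |
    ⟨a, t, A, rfl, ha, rfl⟩
  · simp at hp
  · simp at hp
  · simp at hp
  · exact absurd hS not_red_var
  · exact ⟨_, .mk t ha, by rw [Multiset.map_map]; rfl⟩

theorem reds_map_app_var {E : Sums Mono} {F : Sums Term}
    (h : SumReds Term.Red (E.map (app (var 0))) F) :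
    ∃ F₀, SumReds Mono.Red E F₀ ∧ F = F₀.map (app (var 0)) := by
  induction h with
  | refl => exact ⟨E, .refl, rfl⟩
  | tail _ h ih =>
    obtain ⟨F₀, hF₀, hF⟩ := ih
    obtain @⟨e, S, G, h⟩ := h
    rw [Multiset.singleton_add] at hF
    obtain ⟨t, G, rfl, rfl, rfl⟩ := exists_cons_of_map_eq_cons hF.symm
    obtain ⟨T, hT, rfl⟩ := red_app_var h
    refine ⟨T + G, hF₀.tail ?_, by rw [Multiset.map_add]⟩
    rw [← Multiset.singleton_add]
    exact ⟨G, hT⟩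

/-- Convergence is pulled back from `⟨x⟩ t` along the injection `app (var 0)`, which reflects and
preserves reductions. -/
theorem exists_converges_red (t : Mono) :
    ∃ N, Converges Mono.Red {t} N ∧ (app (var 0) t).NF = N.map (app (var 0)) := by
  have h := converges_nf Term.exists_converges_red (app (var 0) t)
  rw [← Multiset.map_singleton] at h
  obtain ⟨N, hN, hNF⟩ := reds_map_app_var (h.2 _ .refl)
  rw [hNF] at h
  refine ⟨N, ⟨normal_iff.2 fun T hT S hS => ?_, fun E hE => ?_⟩, ?_⟩
  · exact normal_iff.1 h.1 _ (Multiset.mem_map_of_mem _ hT) _ (Red.app_mono hS)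
  · obtain ⟨F, hF, hNF⟩ := reds_map_app_var (h.2 _ (hE.map fun _ _ h => Red.app_mono h))
    rwa [Multiset.map_injective app_var_injective hNF]
  · rw [← hNF, Multiset.map_singleton]
    rfl

end Mono

end Resource

/-! ### The main theorem -/

theorem mainTheorem2 :
    (∀ s : Resource.Term, Resource.Term.Coh s s →
      (∃! N : Resource.Sums Resource.Term, Resource.IsNF Resource.Term.Red {s} N) ∧
      ∀ s' ∈ Resource.supp (Resource.Term.NF s),
        (Resource.coeff (Resource.Term.NF s) s' : ℚ) =
          (Resource.Term.mult s : ℚ) / (Resource.Term.mult s' : ℚ)) ∧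
    (∀ t : Resource.Mono, Resource.Mono.Coh t t →
      (∃! N : Resource.Sums Resource.Mono, Resource.IsNF Resource.Mono.Red {t} N) ∧
      ∀ t' ∈ Resource.supp (Resource.Mono.NF t),
        (Resource.coeff (Resource.Mono.NF t) t' : ℚ) =
          (Resource.Mono.mult t : ℚ) / (Resource.Mono.mult t' : ℚ)) := by
  open Resource in
  have hterm : ∀ s : Term, Term.Coh s s → ∀ s' ∈ s.NF,
      (coeff s.NF s' : ℚ) = (s.mult : ℚ) / (s'.mult : ℚ) := by
    intro s hs s' hs'
    rw [eq_div_iff (Nat.cast_ne_zero.2 s'.mult_pos.ne')]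
    exact_mod_cast Term.coeff_NF hs s' hs'
  refine ⟨fun s hs => ⟨existsUnique_isNF Term.exists_converges_red s, fun s' hs' =>
    hterm s hs s' (mem_supp.1 hs')⟩, fun t ht => ⟨existsUnique_isNF
      (fun t => (Mono.exists_converges_red t).imp fun _ h => h.1) t, fun t' ht' => ?_⟩⟩
  obtain ⟨N, hN, hNF⟩ := Mono.exists_converges_red t
  have ht₁ : Mono.NF t = N := hN.nf_eq
  rw [ht₁] at ht' ⊢
  -- The head variable is coherent with itself and has multiplicity `1`, so the formula for `⟨x⟩ t`
  -- is the one for `t`.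
  have h := hterm (.app (.var 0) t) (Term.coh_app_iff.2 ⟨.var 0, ht⟩) (.app (.var 0) t') (by
    rw [hNF]
    exact Multiset.mem_map_of_mem _ (mem_supp.1 ht'))
  rwa [hNF, coeff_map_of_injective Mono.app_var_injective, Term.mult_app, Term.mult_app,
    Term.mult_var, one_mul, one_mul] at h
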